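/- Let $L$ be a smooth manifold (without boundary, Hausdorff, second countable). A Levi flat structure on $L$ is a pair $(\xi,J)$ where $\xi\subset TL$ is a smooth integrable (involutive) distribution of codimension $1$ and $J:\xi\to\xi$ is a smooth bundle map with $J^2=-I$ that is integrable along the leaves, i.e. its Nijenhuis tensor $[JV,JW]-[V,W]-J[JV,W]-J[V,JW]$ vanishes for all $V,W$ tangent to $\xi$. Fix a Levi flat structure $(\xi,J)$ and a DGLA defining couple $(\gamma,X)$: a smooth $1$-form $\gamma$ and a smooth vector field $X$ with $\ker\gamma=\xi$ and $\gamma(X)=1$. **Notation.** Let $\mathcal Z^1(L)=\{\alpha\in\Lambda^1(L):\alpha(X)=0\}$ and let $\Lambda_J^{0,1}(\xi)\otimes\xi$ be the set of smooth $S:\xi\to\xi$ with $SJ=-JS$. For $1$-forms put $\{a,b\}=\mathcal L_Xa\wedge b-a\wedge\mathcal L_Xb$ and $\delta\alpha=d\alpha+\{\gamma,\alpha\}$. For $\alpha\in\mathcal Z^1(L)$ put $\xi_\alpha=\ker(\gamma+\alpha)$, $\omega_\alpha(V)=V-\alpha(V)X$ (so $\omega_\alpha(\xi)=\xi_\alpha$)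 and $[V,W]_\alpha=\omega_\alpha^{-1}[\omega_\alpha V,\omega_\alpha W]$. For a bracket $[\cdot,\cdot]$ on the vector fields tangent to $\xi$, put $$N(V,W)=[JV,JW]-[V,W]-J[JV,W]-J[V,JW],\qquad (\bar\partial W)(V)=\tfrac12([V,W]+J[JV,W])+\tfrac14N(V,W),$$ $$\bar\partial S(V,W)=\bar\partial(SW)(V)-\bar\partial(SV)(W)-\tfrac12S([V,W]-[JV,JW]),$$ $$[S,S](V,W)=[SV,SW]-[JSV,JSW]-S\big([SV,W]+[V,SW]+J[V,JSW]+J[JSV,W]\big)-\tfrac12\big(SN(SV,W)+SN(V,SW)-N(SV,SW)\big),$$ $$[[S,S]](V,W)=[S,S](V,W)-\tfrac12S\big(N(V,W)-N(SV,SW)\big);$$ write $\bar\partial^\alpha_J$ and $[[\cdot,\cdot]]_\alpha$ for these operators when the bracket is $[\cdot,\cdot]_\alpha$. Finally let $T(V)=[V,X]-\gamma([V,X])X$, $H(V)=\tfrac12(T(V)+JT(JV))$ and $(\alpha^{0,1}_J\wedge H)(V,W)=\tfrac12\big(\alpha(V)HW+\alpha(JV)JHW-\alpha(W)HV-\alpha(JW)JHV\big)$.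 Let $\mathfrak{MC}_{\delta,\mathcal{LF}}(L)$ be the set of all $(\alpha,S)\in\mathcal Z^1(L)\times(\Lambda_J^{0,1}(\xi)\otimes\xi)$ such that $$\delta\alpha+\tfrac12\{\alpha,\alpha\}=0,\qquad \bar\partial_J^\alpha S+\tfrac12[[S,S]]_\alpha=-\alpha_J^{0,1}\wedge H ,$$ and let $\mathfrak{MC}^\circ$ be the subset where $I+S$ is everywhere invertible. To a pair $(\alpha,S)$ with $I+S$ invertible associate $(\xi_\alpha,J_{\alpha,S})$, where $J_{\alpha,S}=\omega_\alpha(I+S)J(I+S)^{-1}\omega_\alpha^{-1}$. **Gauge action.** For $\Phi\in\mathrm{Diff}(L)$ and $(\alpha,S)$ with $I+S$ invertible let $$\beta=\chi(\Phi)(\alpha)=\big(\Phi^*(\gamma+\alpha)(X)\big)^{-1}\Phi^*(\gamma+\alpha)-\gamma,\qquad S_{\chi(\Phi)(\alpha)}=(J+\widetilde J)^{-1}(J-\widetilde J),\quad \widetilde J=\omega_\beta^{-1}\Phi_*^{-1}J_{\alpha,S}\Phi_*\omega_\beta ,$$ which is defined when $\Phi^*(\gamma+\alpha)(X)$ vanishes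 nowhere and $J+\widetilde J$ is everywhere invertible; $S_{\chi(\Phi)(\alpha)}$ is the $Q$ with $QJ=-JQ$ and $\widetilde J=(I+Q)J(I+Q)^{-1}$. Write $(\alpha,S)\sim_{\mathcal G}(\beta,Q)$ if there is a $\Phi\in\mathrm{Diff}(L)$ for which these are defined, with $\beta=\chi(\Phi)(\alpha)$ and $Q=S_{\chi(\Phi)(\alpha)}$. **Deformations.** The deformations of $(\xi,J)$ are the Levi flat structures $(\xi',J')$ on $L$ that are close to $(\xi,J)$ in the following sense: $\xi'$ is everywhere transverse to $X$ and, with $\pi:\xi'\to\xi$ the projection along $X$, $J+\pi J'\pi^{-1}$ is everywhere invertible. The moduli space of deformations of $(\xi,J)$ is the set of these structures modulo the relation of being carried to one another by a diffeomorphism of $L$. **Statement.** 1. For $(\alpha,S)\in\mathcal Z^1(L)\times(\Lambda_J^{0,1}(\xi)\otimes\xi)$ with $I+S$ invertible, $(\xi_\alpha,J_{\alpha,S})$ is a Levi flat structure if and only if $(\alpha,S)\in\mathfrak{MC}_{\delta,\mathcal{LF}}(L)$; the pair $(0,0)$ gives $(\xi,J)$; and $(\alpha,S)\mapsto(\xi_\alpha,J_{\alpha,S})$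 is a bijection from $\mathfrak{MC}^\circ$ onto the set of deformations of $(\xi,J)$. 2. The gauge action preserves $\mathfrak{MC}^\circ$: if it is defined for $\Phi$ and $(\alpha,S)\in\mathfrak{MC}^\circ$, then $(\chi(\Phi)(\alpha),S_{\chi(\Phi)(\alpha)})\in\mathfrak{MC}^\circ$. 3. $\sim_{\mathcal G}$ is an equivalence relation on $\mathfrak{MC}^\circ$, and $(\alpha,S)\sim_{\mathcal G}(\beta,Q)$ if and only if some diffeomorphism of $L$ carries $(\xi_\alpha,J_{\alpha,S})$ to $(\xi_\beta,J_{\beta,Q})$. 4. Consequently $(\alpha,S)\mapsto(\xi_\alpha,J_{\alpha,S})$ induces a bijection from $\mathfrak{MC}^\circ/\!\sim_{\mathcal G}$ onto the moduli space of deformations of $(\xi,J)$. -/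

import Mathlib

open Set
open scoped Manifold ContDiff

noncomputable section

namespace LeviFlat

/-! ### Vector fields and one-forms on a manifold without boundary of dimension `n` -/

section Fields

variable {n : ℕ} {L : Type*} [TopologicalSpace L] [ChartedSpace (EuclideanSpace ℝ (Fin n)) L]

/-- Vector fields (no regularity). -/
abbrev VField (n : ℕ) (L : Type*) [TopologicalSpace L]
    [ChartedSpace (EuclideanSpace ℝ (Fin n)) L] : Type _ :=
  (x : L) → TangentSpace (𝓡 n) x

/-- One-forms (no regularity). -/
abbrev OneForm (n : ℕ) (L : Type*) [TopologicalSpace L]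
    [ChartedSpace (EuclideanSpace ℝ (Fin n)) L] : Type _ :=
  (x : L) → (TangentSpace (𝓡 n) x →L[ℝ] ℝ)

/-- Smooth vector fields. -/
def SmoothField [IsManifold (𝓡 n) ∞ L] (V : VField n L) : Prop :=
  ContMDiff (𝓡 n) (𝓡 n).tangent ∞ (fun x => (⟨x, V x⟩ : TangentBundle (𝓡 n) L))

/-- Smoothness of a one-form on an open set `U`: it takes smooth vector fields to functions
that are smooth on `U`. -/
def SmoothFormOn [IsManifold (𝓡 n) ∞ L] (θ : OneForm n L) (U : Set L) : Prop :=
  ∀ V : VField n L, SmoothField V → ContMDiffOn (𝓡 n) 𝓘(ℝ, ℝ) ∞ (fun x => θ x (V x)) U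

/-- The Lie bracket of vector fields. -/
def lie (V W : VField n L) : VField n L := VectorField.mlieBracket (𝓡 n) V W

/-- The derivative `V f` of a function `f` along a vector field `V`. -/
def dirDeriv (V : VField n L) (f : L → ℝ) (x : L) : ℝ := mfderiv (𝓡 n) 𝓘(ℝ, ℝ) f x (V x)

/-- `dθ (V, W) = V (θ W) - W (θ V) - θ [V, W]`. -/
def extD (θ : OneForm n L) (V W : VField n L) (x : L) : ℝ :=
  dirDeriv V (fun y => θ y (W y)) x - dirDeriv W (fun y => θ y (V y)) x - θ x (lie V W x)

/-- The Lie derivative of a one-form: `(𝓛_X θ) V = X (θ V) - θ [X, V]`. -/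
def lieDer (X : VField n L) (θ : OneForm n L) (V : VField n L) (x : L) : ℝ :=
  dirDeriv X (fun y => θ y (V y)) x - θ x (lie X V x)

/-- The bracket `{a, b} = 𝓛_X a ∧ b - a ∧ 𝓛_X b` of two one-forms, a two-form. The wedge is
normalised by `(a ∧ b) (V, W) = a V * b W - a W * b V`. -/
def formBracket (X : VField n L) (a b : OneForm n L) (V W : VField n L) (x : L) : ℝ :=
  (lieDer X a V x * b x (W x) - lieDer X a W x * b x (V x))
    - (a x (V x) * lieDer X b W x - a x (W x) * lieDer X b V x)

end Fields

/-! ### Complex Lie algebras of derivation type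

The operators attached to a bracket `br` and to operators `J`, `S` on vector fields. -/

section Derivation

variable {g : Type*} [AddCommGroup g] [Module ℝ g]

/-- The Nijenhuis tensor of `J` with respect to the bracket `br`. -/
def nijenhuis (br : g → g → g) (J : g → g) (V W : g) : g :=
  br (J V) (J W) - br V W - J (br (J V) W) - J (br V (J W))

/-- `(∂̄ W) (V)`, for `W` an element of the Lie algebra. -/
def dbarVec (br : g → g → g) (J : g → g) (W V : g) : g :=
  (1 / 2 : ℝ) • (br V W + J (br (J V) W)) + (1 / 4 : ℝ) • nijenhuis br J V W

/-- `(∂̄ S) (V, W)`, for `S` a `(0,1)`-form with values in the Lie algebra. -/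
def dbarEnd (br : g → g → g) (J S : g → g) (V W : g) : g :=
  dbarVec br J (S W) V - dbarVec br J (S V) W
    - (1 / 2 : ℝ) • S (br V W - br (J V) (J W))

/-- `[S, S] (V, W)`. -/
def sBracket (br : g → g → g) (J S : g → g) (V W : g) : g :=
  br (S V) (S W) - br (J (S V)) (J (S W))
    - S (br (S V) W + br V (S W) + J (br V (J (S W))) + J (br (J (S V)) W))
    - (1 / 2 : ℝ) • (S (nijenhuis br J (S V) W) + S (nijenhuis br J V (S W))
        - nijenhuis br J (S V) (S W))

/-- `[[S, S]] (V, W) = [S, S] (V, W) - 1/2 S (N (V, W) - N (S V, S W))`. -/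
def sDoubleBracket (br : g → g → g) (J S : g → g) (V W : g) : g :=
  sBracket br J S V W
    - (1 / 2 : ℝ) • S (nijenhuis br J V W - nijenhuis br J (S V) (S W))

end Derivation

/-! ### Levi flat structures -/

section Structures

variable {n : ℕ} {L : Type*} [TopologicalSpace L] [ChartedSpace (EuclideanSpace ℝ (Fin n)) L]

/-- A field `ξ` of tangent subspaces and a field `J` of endomorphisms of `ξ` (no condition). -/
structure EndoDistribution (n : ℕ) (L : Type*) [TopologicalSpace L]
    [ChartedSpace (EuclideanSpace ℝ (Fin n)) L] where
  ξ : (x : L) → Submodule ℝ (TangentSpace (𝓡 n) x)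
  J : (x : L) → Module.End ℝ (ξ x)

/-- The vector field `V` is tangent to the distribution `ξ`. -/
def TangentTo (ξ : (x : L) → Submodule ℝ (TangentSpace (𝓡 n) x)) (V : VField n L) : Prop :=
  ∀ x, V x ∈ ξ x

open Classical in
/-- The action `V ↦ A V` on vector fields tangent to `ξ` of a field `A` of endomorphisms of `ξ`.
Vectors that are not in `ξ` are sent to `0`; this value is never relevant. -/
def act {ξ : (x : L) → Submodule ℝ (TangentSpace (𝓡 n) x)} (A : (x : L) → Module.End ℝ (ξ x))
    (V : VField n L) : VField n L :=
  fun x => if h : V x ∈ ξ x then ((A x ⟨V x, h⟩ : ξ x) : TangentSpace (𝓡 n) x) else 0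

variable [IsManifold (𝓡 n) ∞ L]

/-- A field of endomorphisms of `ξ` is smooth if it maps smooth sections of `ξ` to smooth
sections of `ξ`. -/
def SmoothEnd {ξ : (x : L) → Submodule ℝ (TangentSpace (𝓡 n) x)}
    (A : (x : L) → Module.End ℝ (ξ x)) : Prop :=
  ∀ V : VField n L, SmoothField V → TangentTo ξ V → SmoothField (act A V)

/-- `ξ` is a smooth distribution of codimension one: locally it is the kernel of a nowhere
vanishing smooth one-form. -/
def SmoothCodimOne (ξ : (x : L) → Submodule ℝ (TangentSpace (𝓡 n) x)) : Prop :=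
  ∀ x : L, ∃ U : Set L, IsOpen U ∧ x ∈ U ∧ ∃ θ : OneForm n L, SmoothFormOn θ U ∧
    ∀ y ∈ U, θ y ≠ 0 ∧ ∀ v : TangentSpace (𝓡 n) y, v ∈ ξ y ↔ θ y v = 0

/-- `ξ` is integrable (involutive). -/
def Involutive (ξ : (x : L) → Submodule ℝ (TangentSpace (𝓡 n) x)) : Prop :=
  ∀ V W : VField n L, SmoothField V → SmoothField W → TangentTo ξ V → TangentTo ξ W →
    TangentTo ξ (lie V W)

/-- `(ξ, J)` is a Levi flat structure: `ξ` is a smooth integrable distribution of codimension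
one and `J` is a smooth complex structure on `ξ` which is integrable along the leaves, that is,
whose Nijenhuis tensor vanishes. -/
structure IsLeviFlat (F : EndoDistribution n L) : Prop where
  codim_one : SmoothCodimOne F.ξ
  involutive : Involutive F.ξ
  smooth_J : SmoothEnd F.J
  J_sq : ∀ x, F.J x * F.J x = -1
  integrable : ∀ V W : VField n L, SmoothField V → SmoothField W →
    TangentTo F.ξ V → TangentTo F.ξ W → nijenhuis lie (act F.J) V W = 0

/-- A DGLA defining couple `(γ, X)` for the distribution `ξ`. -/
structure DefiningCouple (ξ : (x : L) → Submodule ℝ (TangentSpace (𝓡 n) x)) where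
  γ : OneForm n L
  X : VField n L
  smooth_γ : SmoothFormOn γ univ
  smooth_X : SmoothField X
  ker_γ : ∀ (x : L) (v : TangentSpace (𝓡 n) x), v ∈ ξ x ↔ γ x v = 0
  γ_X : ∀ x, γ x (X x) = 1

/-- A diffeomorphism `Φ` of `L` is an isomorphism from `(ξ, J)` to `(ξ', J')`. -/
def IsIsoBy (Φ : Diffeomorph (𝓡 n) (𝓡 n) L L ∞) (F G : EndoDistribution n L) : Prop :=
  (∀ (x : L) (v : TangentSpace (𝓡 n) x),
    v ∈ F.ξ x ↔ mfderiv (𝓡 n) (𝓡 n) Φ x v ∈ G.ξ (Φ x)) ∧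
  ∀ (x : L) (v : F.ξ x) (w : G.ξ (Φ x)),
    (w : TangentSpace (𝓡 n) (Φ x)) = mfderiv (𝓡 n) (𝓡 n) Φ x (v : TangentSpace (𝓡 n) x) →
      ((G.J (Φ x) w : G.ξ (Φ x)) : TangentSpace (𝓡 n) (Φ x)) =
        mfderiv (𝓡 n) (𝓡 n) Φ x ((F.J x v : F.ξ x) : TangentSpace (𝓡 n) x)

/-- `(ξ, J)` and `(ξ', J')` are related by a diffeomorphism of `L`. -/
def Isomorphic (F G : EndoDistribution n L) : Prop :=
  ∃ Φ : Diffeomorph (𝓡 n) (𝓡 n) L L ∞, IsIsoBy Φ F G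

end Structures

/-! ### Maurer-Cartan pairs -/

section MaurerCartan

variable {n : ℕ} {L : Type*} [TopologicalSpace L] [ChartedSpace (EuclideanSpace ℝ (Fin n)) L]
  [IsManifold (𝓡 n) ∞ L] {F : EndoDistribution n L}

/-- `𝒵¹(L)`: the smooth one-forms `α` with `ι_X α = 0`. -/
def ZOne (c : DefiningCouple F.ξ) : Type _ :=
  {α : OneForm n L // SmoothFormOn α univ ∧ ∀ x, α x (c.X x) = 0}

/-- `Λ^{0,1}_J(ξ) ⊗ ξ`: the smooth `ξ`-valued one-forms `S` on `ξ` with `S (J v) = - J (S v)`. -/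
def ZeroOneForm (F : EndoDistribution n L) : Type _ :=
  {S : (x : L) → Module.End ℝ (F.ξ x) // SmoothEnd S ∧ ∀ x, S x * F.J x = -(F.J x * S x)}

/-- `ω_α (V) = V - α (V) X`. -/
def omega (c : DefiningCouple F.ξ) (α : OneForm n L) (V : VField n L) : VField n L :=
  fun x => V x - α x (V x) • c.X x

/-- `ω_α⁻¹ (V) = V + α (V) X`, the inverse of `ω_α` when `α (X) = 0`. -/
def omegaInv (c : DefiningCouple F.ξ) (α : OneForm n L) (V : VField n L) : VField n L :=
  fun x => V x + α x (V x) • c.X x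

/-- `[V, W]_α = ω_α⁻¹ [ω_α V, ω_α W]`. -/
def lieAlpha (c : DefiningCouple F.ξ) (α : OneForm n L) (V W : VField n L) : VField n L :=
  omegaInv c α (lie (omega c α V) (omega c α W))

/-- `T (V) = [V, X] - γ ([V, X]) X`. -/
def tForm (c : DefiningCouple F.ξ) (V : VField n L) : VField n L :=
  fun x => lie V c.X x - c.γ x (lie V c.X x) • c.X x

/-- `H (V) = 1/2 (T (V) + J T (J V))`. -/
def hForm (c : DefiningCouple F.ξ) (V : VField n L) : VField n L :=
  (1 / 2 : ℝ) • (tForm c V + act F.J (tForm c (act F.J V)))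

/-- `α^{0,1} (V) Z`, where `α^{0,1} (V) = 1/2 (α (V) + i α (J V))` and `i` acts on `ξ` as `J`. -/
def zeroOnePart (F : EndoDistribution n L) (α : OneForm n L) (V Z : VField n L) : VField n L :=
  fun x => (1 / 2 : ℝ) • (α x (V x) • Z x + α x (act F.J V x) • act F.J Z x)

/-- `(α^{0,1} ∧ H) (V, W)`. -/
def wedgeH (c : DefiningCouple F.ξ) (α : OneForm n L) (V W : VField n L) : VField n L :=
  zeroOnePart F α V (hForm c W) - zeroOnePart F α W (hForm c V)

/-- `δ α + 1/2 {α, α} = 0`, where `δ α = d α + {γ, α}`. -/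
def EqAlpha (c : DefiningCouple F.ξ) (α : OneForm n L) : Prop :=
  ∀ V W : VField n L, SmoothField V → SmoothField W → ∀ x,
    (extD α V W x + formBracket c.X c.γ α V W x) + (1 / 2) * formBracket c.X α α V W x = 0

/-- `∂̄_J^α S + 1/2 [[S, S]]_α = - α^{0,1} ∧ H`, all operators being those of `[·,·]_α`. The
first equation makes `[·,·]_α` a bracket on the vector fields tangent to `ξ`. -/
def EqS (c : DefiningCouple F.ξ) (α : OneForm n L) (S : (x : L) → Module.End ℝ (F.ξ x)) : Prop :=
  ∀ V W : VField n L, SmoothField V → SmoothField W → TangentTo F.ξ V → TangentTo F.ξ W →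
    dbarEnd (lieAlpha c α) (act F.J) (act S) V W
      + (1 / 2 : ℝ) • sDoubleBracket (lieAlpha c α) (act F.J) (act S) V W = -wedgeH c α V W

/-- The set `𝔐ℭ_{δ,ℒℱ}(L)` of solutions of the two equations. -/
def MC (c : DefiningCouple F.ξ) : Set (ZOne c × ZeroOneForm F) :=
  {p | EqAlpha c p.1.1 ∧ EqS c p.1.1 p.2.1}

/-- `I + S` is invertible, so that `(I + S) J (I + S)⁻¹` makes sense. -/
def InvertibleS (S : ZeroOneForm F) : Prop := ∀ x, IsUnit (1 + S.1 x)

/-- The solutions `(α, S)` which define a deformed structure. -/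
abbrev MCPair (c : DefiningCouple F.ξ) : Type _ :=
  {p : ZOne c × ZeroOneForm F // p ∈ MC c ∧ InvertibleS p.2}

end MaurerCartan

/-! ### The deformed structures, and the gauge action -/

section Deformations

variable {n : ℕ} {L : Type*} [TopologicalSpace L] [ChartedSpace (EuclideanSpace ℝ (Fin n)) L]
  [IsManifold (𝓡 n) ∞ L] {F : EndoDistribution n L}

/-- The projection of the tangent space onto `ξ` along `X`. Its restriction to
`ξ_α = ker (γ + α)` is `ω_α⁻¹ : ξ_α → ξ`. -/
def proj (c : DefiningCouple F.ξ) (x : L) : TangentSpace (𝓡 n) x →ₗ[ℝ] F.ξ x where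
  toFun v := ⟨v - c.γ x v • c.X x, by
    rw [c.ker_γ]
    simp [c.γ_X]⟩
  map_add' v w := by
    apply Subtype.ext
    simp only [map_add, add_smul, Submodule.coe_add]
    abel
  map_smul' r v := by
    apply Subtype.ext
    simp only [map_smul, smul_eq_mul, mul_smul, RingHom.id_apply, Submodule.coe_smul, smul_sub]

/-- `ω_α` on `ξ_x`, with values in the tangent space. -/
def omegaAt (c : DefiningCouple F.ξ) (α : OneForm n L) (x : L) :
    F.ξ x →ₗ[ℝ] TangentSpace (𝓡 n) x where
  toFun v := (v : TangentSpace (𝓡 n) x) - α x (v : TangentSpace (𝓡 n) x) • c.X x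
  map_add' v w := by
    simp only [Submodule.coe_add, map_add, add_smul]
    abel
  map_smul' r v := by
    simp only [Submodule.coe_smul, map_smul, smul_eq_mul, mul_smul, RingHom.id_apply, smul_sub]

/-- `(I + S) J (I + S)⁻¹`. -/
def twist (S : ZeroOneForm F) (x : L) : Module.End ℝ (F.ξ x) :=
  (1 + S.1 x) * F.J x * Ring.inverse (1 + S.1 x)

/-- `ω_α (I + S) J (I + S)⁻¹ ω_α⁻¹`, precomposed with the projection along `X`. -/
def jAlpha (c : DefiningCouple F.ξ) (α : ZOne c) (S : ZeroOneForm F) (x : L) :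
    Module.End ℝ (TangentSpace (𝓡 n) x) :=
  omegaAt c α.1 x ∘ₗ twist S x ∘ₗ proj c x

theorem jAlpha_mem (c : DefiningCouple F.ξ) (α : ZOne c) (S : ZeroOneForm F) (x : L)
    (v : TangentSpace (𝓡 n) x) :
    jAlpha c α S x v ∈ LinearMap.ker ((c.γ x + α.1 x : TangentSpace (𝓡 n) x →L[ℝ] ℝ) :
      TangentSpace (𝓡 n) x →ₗ[ℝ] ℝ) := by
  have h := (c.ker_γ x _).1 (twist S x (proj c x v)).2
  simp [jAlpha, omegaAt, h, c.γ_X, α.2.2]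

/-- The structure `(ξ_α, J_α)` defined by `(α, S)`: `ξ_α = ker (γ + α)` and
`J_α = ω_α (I + S) J (I + S)⁻¹ ω_α⁻¹`. -/
def deform (c : DefiningCouple F.ξ) (p : ZOne c × ZeroOneForm F) : EndoDistribution n L where
  ξ x := LinearMap.ker ((c.γ x + p.1.1 x : TangentSpace (𝓡 n) x →L[ℝ] ℝ) :
      TangentSpace (𝓡 n) x →ₗ[ℝ] ℝ)
  J x := (jAlpha c p.1 p.2 x).restrict (fun v _ => jAlpha_mem c p.1 p.2 x v)

/-- The structure `(ξ', J')` is close to `(ξ, J)`: the distribution `ξ'` is transverse to `X`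
and, for `π : ξ' → ξ` the projection along `X`, the map `J π + π J' : ξ' → ξ` is injective, that
is, `det (J + π J' π⁻¹) ≠ 0`. -/
def CloseTo (c : DefiningCouple F.ξ) (G : EndoDistribution n L) : Prop :=
  ∀ x, c.X x ∉ G.ξ x ∧ ∀ v : G.ξ x,
    F.J x (proj c x (v : TangentSpace (𝓡 n) x))
      + proj c x ((G.J x v : G.ξ x) : TangentSpace (𝓡 n) x) = 0 → v = 0

/-- The space of deformations: the Levi flat structures on `L` that are close to `(ξ, J)`. -/
abbrev Deformation (c : DefiningCouple F.ξ) : Type _ :=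
  {G : EndoDistribution n L // IsLeviFlat G ∧ CloseTo c G}

/-- The pull-back `Φ^* (γ + α)`. -/
def pullForm (c : DefiningCouple F.ξ) (Φ : Diffeomorph (𝓡 n) (𝓡 n) L L ∞) (α : ZOne c) :
    OneForm n L :=
  fun x => (c.γ (Φ x) + α.1 (Φ x)).comp (mfderiv (𝓡 n) (𝓡 n) Φ x)

/-- `χ(Φ)(α) = (Φ^* (γ + α) (X))⁻¹ Φ^* (γ + α) - γ`. -/
def chi (c : DefiningCouple F.ξ) (Φ : Diffeomorph (𝓡 n) (𝓡 n) L L ∞) (α : ZOne c) :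
    OneForm n L :=
  fun x => (pullForm c Φ α x (c.X x))⁻¹ • pullForm c Φ α x - c.γ x

/-- `ω_β⁻¹ Φ_*⁻¹ J_α Φ_* ω_β` on `ξ`, for `β = χ(Φ)(α)` and `J_α` the complex structure defined
by `(α, S)`. -/
def pulledJ (c : DefiningCouple F.ξ) (Φ : Diffeomorph (𝓡 n) (𝓡 n) L L ∞)
    (p : ZOne c × ZeroOneForm F) (x : L) : Module.End ℝ (F.ξ x) :=
  proj c x ∘ₗ ((mfderiv (𝓡 n) (𝓡 n) Φ x).inverse :
      TangentSpace (𝓡 n) (Φ x) →ₗ[ℝ] TangentSpace (𝓡 n) x) ∘ₗ jAlpha c p.1 p.2 (Φ x) ∘ₗ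
    (mfderiv (𝓡 n) (𝓡 n) Φ x : TangentSpace (𝓡 n) x →ₗ[ℝ] TangentSpace (𝓡 n) (Φ x)) ∘ₗ
      omegaAt c (chi c Φ p.1) x

/-- The action of `Φ` on `(α, S)` is defined: `Φ^* (γ + α) (X)` vanishes nowhere, and
`J + ω_β⁻¹ Φ_*⁻¹ J_α Φ_* ω_β` is invertible, where `β = χ(Φ)(α)`. -/
def GaugeDefined (c : DefiningCouple F.ξ) (Φ : Diffeomorph (𝓡 n) (𝓡 n) L L ∞)
    (p : ZOne c × ZeroOneForm F) : Prop :=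
  ∀ x, pullForm c Φ p.1 x (c.X x) ≠ 0 ∧ IsUnit (F.J x + pulledJ c Φ p x)

/-- `S_{χ(Φ)(α)}`: the `(0,1)`-form `Q` with `(I + Q) J (I + Q)⁻¹ = J'` for
`J' = ω_β⁻¹ Φ_*⁻¹ J_α Φ_* ω_β`, that is, `Q = (J + J')⁻¹ (J - J')`. -/
def gaugeS (c : DefiningCouple F.ξ) (Φ : Diffeomorph (𝓡 n) (𝓡 n) L L ∞)
    (p : ZOne c × ZeroOneForm F) (x : L) : Module.End ℝ (F.ξ x) :=
  Ring.inverse (F.J x + pulledJ c Φ p x) * (F.J x - pulledJ c Φ p x)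

/-- `Φ` takes `(α, S)` to `(β, Q) = (χ(Φ)(α), S_{χ(Φ)(α)})`. -/
def GaugeBy (c : DefiningCouple F.ξ) (Φ : Diffeomorph (𝓡 n) (𝓡 n) L L ∞)
    (p q : ZOne c × ZeroOneForm F) : Prop :=
  GaugeDefined c Φ p ∧ q.1.1 = chi c Φ p.1 ∧ q.2.1 = gaugeS c Φ p

/-- Gauge equivalence of solutions. -/
def GaugeEquiv (c : DefiningCouple F.ξ) (p q : MCPair c) : Prop :=
  ∃ Φ : Diffeomorph (𝓡 n) (𝓡 n) L L ∞, GaugeBy c Φ p.1 q.1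

/-- The moduli space of deformations of `(ξ, J)`: the deformations modulo the diffeomorphisms
of `L`. -/
def ModuliSpace (c : DefiningCouple F.ξ) : Type _ :=
  Quot (fun G G' : Deformation c => Isomorphic G.1 G'.1)

/-- The solutions of the Maurer-Cartan equations modulo gauge equivalence. -/
def MCQuotient (c : DefiningCouple F.ξ) : Type _ := Quot (GaugeEquiv c)

end Deformations

end LeviFlat

end

/-!
A distribution transverse to `X` is `ξ_α = ker (γ + α)` for exactly one form `α` with `α (X) = 0`,
and `ω_α` carries a complex structure `J'` on `ξ_α` to a complex structure `K` on `ξ`. If `J + K`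
is invertible, then the Cayley transform `S = (J + K)⁻¹ (J - K)` is the only `S` which
anticommutes with `J` and satisfies `K = (1 + S) J (1 + S)⁻¹`. Hence the pairs `(α, S)` parametrise
the pairs `(ξ', J')` close to `(ξ, J)`, and only the integrability conditions have to be translated.

By Frobenius, `ker θ` with `θ (X) = 1` is involutive exactly when `dθ + 1/2 {θ, θ} = 0`. For
`θ = γ + α` this is the first equation, because it holds for `γ`. The second one comes from an
identity valid for every skew bilinear bracket: with `u = 1 + S`, the tensor
`(1 - S) N_K (u V, u W)` equals `N_J (V, W) - 4 (∂̄ S + 1/2 [[S, S]]) (V, W)`. Moreover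
`[V, W]_α = [V, W] - α (W) T V + α (V) T W`, so that `N_J` is `-4 α^{0,1} ∧ H` for this bracket.

The gauge action of `Φ` is defined on `(α, S)` when the pull-back of `(ξ_α, J_{α,S})` by `Φ` is
close to `(ξ, J)`, and then its value is the pair that parametrises this pull-back.
-/

noncomputable section

namespace LeviFlat

/-! ### Cayley transforms of complex structures -/

section Cayley

variable {R : Type*} [Ring R] {J K S u : R}

/-- The Cayley transform `(J + K)⁻¹ (J - K)` of a pair of complex structures. It is the `S`
anticommuting with `J` for which `K = (1 + S) J (1 + S)⁻¹`. -/
def cayley (J K : R) : R := Ring.inverse (J + K) * (J - K)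

theorem isUnit_of_mul_self_eq_neg_one (hJ : J * J = -1) : IsUnit J :=
  ⟨⟨J, -J, by rw [mul_neg, hJ, neg_neg], by rw [neg_mul, hJ, neg_neg]⟩, rfl⟩

theorem semiconjBy_iff_eq_mul_inverse (hu : IsUnit u) :
    SemiconjBy u J K ↔ K = u * J * Ring.inverse u := by
  rw [SemiconjBy, eq_comm, Ring.eq_mul_inverse_iff_mul_eq _ _ _ hu]

theorem mul_self_eq_neg_one_of_semiconjBy (hJ : J * J = -1) (hu : IsUnit u)
    (h : SemiconjBy u J K) : K * K = -1 := by
  refine hu.mul_right_cancel ?_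
  rw [← h.mul_right h, hJ, mul_neg, mul_one, neg_one_mul]

theorem isUnit_one_sub_of_anticomm (hJ : J * J = -1) (hS : S * J = -(J * S))
    (hu : IsUnit (1 + S)) : IsUnit (1 - S) := by
  have hJu := isUnit_of_mul_self_eq_neg_one hJ
  have : J * (1 + S) = (1 - S) * J := by
    rw [mul_add, sub_mul, hS, mul_one, one_mul, sub_neg_eq_add]
  exact (IsUnit.mul_right_iff hJu).1 (this ▸ hJu.mul hu)

theorem semiconjBy_one_sub (hS : S * J = -(J * S)) (hu : IsUnit (1 + S))
    (hK : SemiconjBy (1 + S) J K) : SemiconjBy (1 - S) K J := by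
  refine hu.mul_right_cancel ?_
  have hSS : S * S * J = J * (S * S) := by
    rw [mul_assoc, hS, mul_neg, ← mul_assoc, hS, neg_mul, neg_neg, mul_assoc]
  calc (1 - S) * K * (1 + S) = J - S * S * J := by rw [mul_assoc, ← hK.eq]; noncomm_ring
    _ = J * (1 - S) * (1 + S) := by rw [hSS]; noncomm_ring

theorem add_mul_one_add (hS : S * J = -(J * S)) (hK : SemiconjBy (1 + S) J K) :
    (J + K) * (1 + S) = 2 * J := by
  rw [add_mul, ← hK.eq, mul_add, add_mul, hS]
  noncomm_ring

theorem isUnit_add_of_semiconjBy (h2 : IsUnit (2 : R)) (hJ : J * J = -1)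
    (hS : S * J = -(J * S)) (hu : IsUnit (1 + S)) (hK : SemiconjBy (1 + S) J K) :
    IsUnit (J + K) := by
  rw [← IsUnit.mul_right_iff hu, add_mul_one_add hS hK]
  exact h2.mul (isUnit_of_mul_self_eq_neg_one hJ)

theorem add_mul_cayley (hu : IsUnit (J + K)) : (J + K) * cayley J K = J - K := by
  rw [cayley, ← mul_assoc, Ring.mul_inverse_cancel _ hu, one_mul]

theorem cayley_eq_of_semiconjBy (h2 : IsUnit (2 : R)) (hJ : J * J = -1)
    (hS : S * J = -(J * S)) (hu : IsUnit (1 + S)) (hK : SemiconjBy (1 + S) J K) :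
    cayley J K = S := by
  have hJK := isUnit_add_of_semiconjBy h2 hJ hS hu hK
  refine hJK.mul_left_cancel ?_
  calc (J + K) * cayley J K = 2 * J - (J + K) := by rw [add_mul_cayley hJK]; noncomm_ring
    _ = (J + K) * S := by rw [← add_mul_one_add hS hK]; noncomm_ring

theorem add_mul_one_add_cayley (hu : IsUnit (J + K)) :
    (J + K) * (1 + cayley J K) = 2 * J := by
  rw [mul_add, add_mul_cayley hu]
  noncomm_ring

theorem cayley_anticomm (hJ : J * J = -1) (hK : K * K = -1) (hu : IsUnit (J + K)) :
    cayley J K * J = -(J * cayley J K) := by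
  refine hu.mul_left_cancel ?_
  have hcomm : (J + K) * J = K * (J + K) := by rw [add_mul, mul_add, hJ, hK, add_comm]
  calc (J + K) * (cayley J K * J) = (J - K) * J := by rw [← mul_assoc, add_mul_cayley hu]
    _ = -(K * (J - K)) := by rw [sub_mul, mul_sub, hJ, hK]; abel
    _ = (J + K) * -(J * cayley J K) := by
      rw [mul_neg, ← mul_assoc, hcomm, mul_assoc, add_mul_cayley hu]

theorem isUnit_one_add_cayley (h2 : IsUnit (2 : R)) (hJ : J * J = -1) (hu : IsUnit (J + K)) :
    IsUnit (1 + cayley J K) := by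
  rw [← IsUnit.mul_left_iff hu, add_mul_one_add_cayley hu]
  exact h2.mul (isUnit_of_mul_self_eq_neg_one hJ)

theorem semiconjBy_one_add_cayley (hJ : J * J = -1) (hK : K * K = -1) (hu : IsUnit (J + K)) :
    SemiconjBy (1 + cayley J K) J K := by
  refine hu.mul_left_cancel ?_
  have hcomm : (J + K) * K = J * (J + K) := by rw [add_mul, mul_add, hJ, hK, add_comm]
  calc (J + K) * ((1 + cayley J K) * J) = J * (2 * J) := by
        rw [← mul_assoc, add_mul_one_add_cayley hu, two_mul, add_mul, mul_add]
    _ = (J + K) * (K * (1 + cayley J K)) := by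
      rw [← mul_assoc (J + K), hcomm, mul_assoc, add_mul_one_add_cayley hu]

theorem semiconjBy_one_add_iff_eq_cayley (h2 : IsUnit (2 : R)) (hJ : J * J = -1)
    (hK : K * K = -1) (hS : S * J = -(J * S)) (hu : IsUnit (1 + S)) :
    SemiconjBy (1 + S) J K ↔ IsUnit (J + K) ∧ S = cayley J K :=
  ⟨fun h => ⟨isUnit_add_of_semiconjBy h2 hJ hS hu h, (cayley_eq_of_semiconjBy h2 hJ hS hu h).symm⟩,
    fun h => h.2 ▸ semiconjBy_one_add_cayley hJ hK h.1⟩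

theorem isUnit_two_of_algebra (𝕜 : Type*) [Field 𝕜] [NeZero (2 : 𝕜)] [Algebra 𝕜 R] :
    IsUnit (2 : R) := by
  rw [← map_ofNat (algebraMap 𝕜 R) 2]
  exact (isUnit_iff_ne_zero.2 (NeZero.ne (2 : 𝕜))).map _

end Cayley

/-! ### The Maurer-Cartan expression of a twisted complex structure -/

section Bracket

variable {g h : Type*} [AddCommGroup g] [Module ℝ g] [AddCommGroup h] [Module ℝ h]

section Map

variable {br : g → g → g} {J S : g → g} {br' : h → h → h} {J' S' : h → h} (φ : g →ₗ[ℝ] h)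
  (hbr : ∀ V W, φ (br V W) = br' (φ V) (φ W)) (hJ : ∀ V, φ (J V) = J' (φ V))
  (hS : ∀ V, φ (S V) = S' (φ V))

include hbr hJ in
theorem map_nijenhuis (V W : g) :
    φ (nijenhuis br J V W) = nijenhuis br' J' (φ V) (φ W) := by
  simp only [nijenhuis, map_sub, hbr, hJ]

include hbr hJ hS in
theorem map_dbarEnd (V W : g) :
    φ (dbarEnd br J S V W) = dbarEnd br' J' S' (φ V) (φ W) := by
  simp only [dbarEnd, dbarVec, map_sub, map_add, map_smul, hbr, hJ, hS,
    map_nijenhuis φ hbr hJ]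

include hbr hJ hS in
theorem map_sDoubleBracket (V W : g) :
    φ (sDoubleBracket br J S V W) = sDoubleBracket br' J' S' (φ V) (φ W) := by
  simp only [sDoubleBracket, sBracket, map_sub, map_add, map_smul, hbr, hJ, hS,
    map_nijenhuis φ hbr hJ]

end Map

theorem nijenhuis_sub_smul_maurerCartan {br : g →ₗ[ℝ] g →ₗ[ℝ] g} {J S K : Module.End ℝ g}
    (hbr : ∀ a b, br a b = -br b a) (hS : S * J = -(J * S)) (hK : SemiconjBy (1 + S) J K)
    (hK' : SemiconjBy (1 - S) K J) (V W : g) :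
    nijenhuis (br · ·) J V W
        - (4 : ℝ) • (dbarEnd (br · ·) J S V W + (1 / 2 : ℝ) • sDoubleBracket (br · ·) J S V W)
      = (1 - S) (nijenhuis (br · ·) K ((1 + S) V) ((1 + S) W)) := by
  have hSJ (a : g) : S (J a) = -J (S a) := LinearMap.congr_fun hS a
  have hKS (a : g) : K (a + S a) = J a - J (S a) := by
    simpa [hSJ, ← sub_eq_add_neg] using (LinearMap.congr_fun hK.eq a).symm
  have hSK (b : g) : S (K b) = K b - (J b - J (S b)) := by
    have : K b - S (K b) = J b - J (S b) := by simpa using LinearMap.congr_fun hK'.eq b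
    rw [← this, sub_sub_cancel]
  simp only [nijenhuis, dbarEnd, dbarVec, sDoubleBracket, sBracket, LinearMap.sub_apply,
    LinearMap.add_apply, Module.End.one_apply, hKS, map_sub, map_add, map_neg, hSK, hSJ,
    hbr W (S V), hbr (J W) (S V), hbr (J W) (J (S V)), hbr W (J (S V))]
  module

theorem nijenhuis_eq_zero_iff_maurerCartan {R : Type*} [Ring R] {br : g →ₗ[ℝ] g →ₗ[ℝ] g}
    (hbr : ∀ a b, br a b = -br b a) (ρ : R →+* Module.End ℝ g) {J S K : R} (hJ : J * J = -1)
    (hS : S * J = -(J * S)) (hu : IsUnit (1 + S)) (hK : SemiconjBy (1 + S) J K) :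
    (∀ V W, nijenhuis (br · ·) (ρ K) V W = 0) ↔ ∀ V W, nijenhuis (br · ·) (ρ J) V W
      = (4 : ℝ) • (dbarEnd (br · ·) (ρ J) (ρ S) V W
        + (1 / 2 : ℝ) • sDoubleBracket (br · ·) (ρ J) (ρ S) V W) := by
  have map_one_add : ρ (1 + S) = 1 + ρ S := by rw [map_add, map_one]
  have map_one_sub : ρ (1 - S) = 1 - ρ S := by rw [map_sub, map_one]
  have surjective := ((Module.End.isUnit_iff _).1 (map_one_add ▸ hu.map ρ)).surjective
  have injective := ((Module.End.isUnit_iff _).1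
    (map_one_sub ▸ (isUnit_one_sub_of_anticomm hJ hS hu).map ρ)).injective
  refine surjective.forall₂.trans <| forall₂_congr fun V W => ?_
  rw [← map_eq_zero_iff _ injective, ← nijenhuis_sub_smul_maurerCartan hbr
    (by rw [← map_mul, hS, map_neg, map_mul]) (map_one_add ▸ hK.map ρ)
    (map_one_sub ▸ (semiconjBy_one_sub hS hu hK).map ρ), sub_eq_zero]

end Bracket

/-! ### Calculus of smooth vector fields -/

section Calculus

variable {n : ℕ} {L : Type*} [TopologicalSpace L] [ChartedSpace (EuclideanSpace ℝ (Fin n)) L]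
  {V V' W W' : VField n L} {f g : L → ℝ}

theorem lie_swap (V W : VField n L) : lie V W = -lie W V := VectorField.mlieBracket_swap

theorem lie_self (V : VField n L) : lie V V = 0 := VectorField.mlieBracket_self

theorem dirDeriv_smul_left (g : L → ℝ) (V : VField n L) (f : L → ℝ) (x : L) :
    dirDeriv (g • V) f x = g x * dirDeriv V f x :=
  map_smul (mfderiv (𝓡 n) 𝓘(ℝ, ℝ) f x) _ _

theorem dirDeriv_add (hf : ContMDiff (𝓡 n) 𝓘(ℝ, ℝ) ∞ f) (hg : ContMDiff (𝓡 n) 𝓘(ℝ, ℝ) ∞ g)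
    (V : VField n L) (x : L) :
    dirDeriv V (fun y => f y + g y) x = dirDeriv V f x + dirDeriv V g x :=
  congrArg (· (V x)) (mfderiv_add (hf.contMDiffAt.mdifferentiableAt (x := x) (by simp))
    (hg.contMDiffAt.mdifferentiableAt (x := x) (by simp)))

variable [IsManifold (𝓡 n) ∞ L]

theorem SmoothField.zero : SmoothField (0 : VField n L) :=
  Bundle.contMDiff_zeroSection ℝ (TangentSpace (𝓡 n) : L → Type _)

theorem SmoothField.add (hV : SmoothField V) (hW : SmoothField W) : SmoothField (V + W) :=
  ContMDiff.add_section hV hW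

theorem SmoothField.sub (hV : SmoothField V) (hW : SmoothField W) : SmoothField (V - W) :=
  ContMDiff.sub_section hV hW

theorem SmoothField.neg (hV : SmoothField V) : SmoothField (-V) :=
  ContMDiff.neg_section hV

theorem SmoothField.smul (hf : ContMDiff (𝓡 n) 𝓘(ℝ, ℝ) ∞ f) (hV : SmoothField V) :
    SmoothField (f • V) :=
  ContMDiff.smul_section hf hV

theorem SmoothField.const_smul (a : ℝ) (hV : SmoothField V) : SmoothField (a • V) :=
  ContMDiff.const_smul_section hV

theorem SmoothField.mdifferentiableAt (hV : SmoothField V) (x : L) :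
    MDifferentiableAt (𝓡 n) (𝓡 n).tangent (fun y => (⟨y, V y⟩ : TangentBundle (𝓡 n) L)) x :=
  (ContMDiff.contMDiffAt hV).mdifferentiableAt (by simp)

theorem SmoothField.lie (hV : SmoothField V) (hW : SmoothField W) :
    SmoothField (LeviFlat.lie V W) := by
  have : IsManifold (𝓡 n) (((⊤ : ℕ∞) : ℕ∞ω) + 1) L := by
    simpa using (inferInstance : IsManifold (𝓡 n) ∞ L)
  have : IsManifold (𝓡 n) (minSmoothness ℝ 2) L := by
    rw [minSmoothness_of_isRCLikeNormedField]
    infer_instance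
  exact ContDiff.mlieBracket_vectorField (m := ⊤) (n := ⊤) hV hW (by simp)

theorem SmoothFormOn.contMDiff {θ : OneForm n L} (hθ : SmoothFormOn θ univ)
    (hV : SmoothField V) : ContMDiff (𝓡 n) 𝓘(ℝ, ℝ) ∞ (fun x => θ x (V x)) :=
  contMDiffOn_univ.1 (hθ V hV)

theorem SmoothFormOn.add {θ η : OneForm n L} {U : Set L} (hθ : SmoothFormOn θ U)
    (hη : SmoothFormOn η U) : SmoothFormOn (θ + η) U :=
  fun V hV => (hθ V hV).add (hη V hV)

theorem SmoothFormOn.sub {θ η : OneForm n L} {U : Set L} (hθ : SmoothFormOn θ U)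
    (hη : SmoothFormOn η U) : SmoothFormOn (θ - η) U :=
  fun V hV => (hθ V hV).sub (hη V hV)

theorem lie_add_left (hV : SmoothField V) (hV' : SmoothField V') :
    lie (V + V') W = lie V W + lie V' W :=
  funext fun x =>
    VectorField.mlieBracket_add_left (hV.mdifferentiableAt x) (hV'.mdifferentiableAt x)

theorem lie_add_right (hW : SmoothField W) (hW' : SmoothField W') :
    lie V (W + W') = lie V W + lie V W' :=
  funext fun x =>
    VectorField.mlieBracket_add_right (hW.mdifferentiableAt x) (hW'.mdifferentiableAt x)

theorem lie_const_smul_left (a : ℝ) (hV : SmoothField V) : lie (a • V) W = a • lie V W :=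
  funext fun x => VectorField.mlieBracket_const_smul_left (hV.mdifferentiableAt x)

theorem lie_const_smul_right (a : ℝ) (hW : SmoothField W) : lie V (a • W) = a • lie V W :=
  funext fun x => VectorField.mlieBracket_const_smul_right (hW.mdifferentiableAt x)

theorem lie_sub_left (hV : SmoothField V) (hV' : SmoothField V') :
    lie (V - V') W = lie V W - lie V' W := by
  rw [eq_sub_iff_add_eq, ← lie_add_left (hV.sub hV') hV', sub_add_cancel]

theorem lie_sub_right (hW : SmoothField W) (hW' : SmoothField W') :
    lie V (W - W') = lie V W - lie V W' := by
  rw [eq_sub_iff_add_eq, ← lie_add_right (hW.sub hW') hW', sub_add_cancel]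

theorem lie_smul_right (hf : ContMDiff (𝓡 n) 𝓘(ℝ, ℝ) ∞ f) (hW : SmoothField W) (x : L) :
    lie V (f • W) x = dirDeriv V f x • W x + f x • lie V W x :=
  VectorField.mlieBracket_smul_right (hf.contMDiffAt.mdifferentiableAt (by simp))
    (hW.mdifferentiableAt x)

theorem lie_smul_left (hf : ContMDiff (𝓡 n) 𝓘(ℝ, ℝ) ∞ f) (hV : SmoothField V) (x : L) :
    lie (f • V) W x = -dirDeriv W f x • V x + f x • lie V W x := by
  exact VectorField.mlieBracket_smul_left (W := W)
    (hf.contMDiffAt.mdifferentiableAt (by simp)) (hV.mdifferentiableAt x)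

theorem lie_sub_smul_sub_smul {X : VField n L} (hX : SmoothField X)
    (hf : ContMDiff (𝓡 n) 𝓘(ℝ, ℝ) ∞ f) (hg : ContMDiff (𝓡 n) 𝓘(ℝ, ℝ) ∞ g)
    (hV : SmoothField V) (hW : SmoothField W) (x : L) :
    lie (V - f • X) (W - g • X) x = lie V W x - g x • lie V X x + f x • lie W X x
      + (dirDeriv W f x - dirDeriv V g x + f x * dirDeriv X g x - g x * dirDeriv X f x) • X x := by
  have hfX := SmoothField.smul hf hX
  have hgX := SmoothField.smul hg hX
  simp only [lie_sub_left hV hfX, lie_sub_right hW hgX, Pi.sub_apply, lie_smul_left hf hX,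
    lie_smul_right hg hX, dirDeriv_smul_left, lie_self, Pi.zero_apply, smul_zero,
    lie_swap X W, Pi.neg_apply]
  module

end Calculus

/-! ### Integrability of the kernel of a one-form -/

section Frobenius

variable {n : ℕ} {L : Type*} [TopologicalSpace L] [ChartedSpace (EuclideanSpace ℝ (Fin n)) L]
  [IsManifold (𝓡 n) ∞ L] {X : VField n L} {θ η : OneForm n L}

/-- The two-form `dθ + 1/2 {θ, θ}`. When `θ (X) = 1` it measures the failure of `ker θ` to be
integrable. -/
def curvature (X : VField n L) (θ : OneForm n L) (V W : VField n L) (x : L) : ℝ :=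
  extD θ V W x + (1 / 2) * formBracket X θ θ V W x

theorem curvature_add (hθ : SmoothFormOn θ univ) (hη : SmoothFormOn η univ)
    {V W : VField n L} (hV : SmoothField V) (hW : SmoothField W) (x : L) :
    curvature X (θ + η) V W x = curvature X θ V W x +
      ((extD η V W x + formBracket X θ η V W x) + (1 / 2) * formBracket X η η V W x) := by
  simp only [curvature, extD, formBracket, lieDer, Pi.add_apply, add_apply,
    dirDeriv_add (hθ.contMDiff hV) (hη.contMDiff hV),
    dirDeriv_add (hθ.contMDiff hW) (hη.contMDiff hW)]
  ring

theorem curvature_eq_neg_apply_lie (hX : SmoothField X) (hθ : SmoothFormOn θ univ)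
    (hθX : ∀ x, θ x (X x) = 1) {V W : VField n L} (hV : SmoothField V) (hW : SmoothField W)
    (x : L) :
    curvature X θ V W x =
      -θ x (lie (V - (fun y => θ y (V y)) • X) (W - (fun y => θ y (W y)) • X) x) := by
  rw [lie_sub_smul_sub_smul hX (hθ.contMDiff hV) (hθ.contMDiff hW) hV hW]
  simp only [curvature, extD, formBracket, lieDer, lie_swap X V, lie_swap X W, Pi.neg_apply,
    map_add, map_sub, map_neg, map_smul, smul_eq_mul, hθX]
  ring

theorem involutive_iff_curvature_eq_zero (hX : SmoothField X) (hθ : SmoothFormOn θ univ)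
    (hθX : ∀ x, θ x (X x) = 1) {ξ : (x : L) → Submodule ℝ (TangentSpace (𝓡 n) x)}
    (hξ : ∀ x v, v ∈ ξ x ↔ θ x v = 0) :
    Involutive ξ ↔ ∀ V W : VField n L, SmoothField V → SmoothField W →
      ∀ x, curvature X θ V W x = 0 := by
  constructor
  · intro h V W hV hW x
    have smooth_proj {Z : VField n L} (hZ : SmoothField Z) :
        SmoothField (Z - (fun y => θ y (Z y)) • X) := hZ.sub ((hθ.contMDiff hZ).smul_section hX)
    have tangent_proj (Z : VField n L) : TangentTo ξ (Z - (fun y => θ y (Z y)) • X) := fun y => by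
      simp [hξ, hθX]
    rw [curvature_eq_neg_apply_lie hX hθ hθX hV hW, neg_eq_zero, ← hξ]
    exact h _ _ (smooth_proj hV) (smooth_proj hW) (tangent_proj V) (tangent_proj W) x
  · intro h V W hV hW tV tW x
    have proj_eq {Z : VField n L} (hZ : TangentTo ξ Z) : Z - (fun y => θ y (Z y)) • X = Z := by
      ext1 y
      simp [(hξ _ _).1 (hZ y)]
    rw [hξ, ← neg_eq_zero, ← h V W hV hW x, curvature_eq_neg_apply_lie hX hθ hθX hV hW,
      proj_eq tV, proj_eq tW]

end Frobenius

/-! ### Smoothness of the inverse of a field of endomorphisms -/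

section Inverse

section Cramer

variable {𝕜 : Type*} [NontriviallyNormedField 𝕜] {E H M : Type*} [NormedAddCommGroup E]
  [NormedSpace 𝕜 E] [TopologicalSpace H] {I : ModelWithCorners 𝕜 E H} [TopologicalSpace M]
  [ChartedSpace H M] {k : ℕ∞ω} {ι : Type*} [Fintype ι] [DecidableEq ι] {x : M}
  {A : M → Matrix ι ι 𝕜}

theorem contMDiffAt_matrix_det (hA : ∀ i j, ContMDiffAt I 𝓘(𝕜, 𝕜) k (fun y => A y i j) x) :
    ContMDiffAt I 𝓘(𝕜, 𝕜) k (fun y => (A y).det) x := by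
  simp only [Matrix.det_apply']
  exact contMDiffAt_finsetSum fun σ _ =>
    contMDiffAt_const.mul (contMDiffAt_finsetProd fun i _ => hA _ _)

theorem contMDiffAt_of_mulVec_eventuallyEq {b w : M → ι → 𝕜}
    (hA : ∀ i j, ContMDiffAt I 𝓘(𝕜, 𝕜) k (fun y => A y i j) x)
    (hb : ∀ i, ContMDiffAt I 𝓘(𝕜, 𝕜) k (fun y => b y i) x)
    (hdet : ∀ᶠ y in nhds x, (A y).det ≠ 0) (h : ∀ᶠ y in nhds x, (A y).mulVec (w y) = b y) (i : ι) :
    ContMDiffAt I 𝓘(𝕜, 𝕜) k (fun y => w y i) x := by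
  have cramer : ∀ᶠ y in nhds x, w y i = ((A y).updateCol i (b y)).det / (A y).det := by
    filter_upwards [hdet, h] with y hy hw
    rw [eq_div_iff hy, ← Matrix.cramer_apply, ← hw, Matrix.cramer_eq_adjugate_mulVec,
      Matrix.mulVec_mulVec, Matrix.adjugate_mul, Matrix.smul_mulVec, Matrix.one_mulVec,
      Pi.smul_apply, smul_eq_mul, mul_comm]
  refine ContMDiffAt.congr_of_eventuallyEq ?_ cramer
  refine (contMDiffAt_matrix_det fun r j => ?_).div₀ (contMDiffAt_matrix_det hA)
    hdet.self_of_nhds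
  obtain rfl | hj := eq_or_ne j i
  · simpa using hb r
  · simpa [Matrix.updateCol_ne hj] using hA r j

end Cramer

variable {n : ℕ} {L : Type*} [TopologicalSpace L] [ChartedSpace (EuclideanSpace ℝ (Fin n)) L]
  [IsManifold (𝓡 n) ∞ L] [T2Space L]

theorem exists_smoothField_eventuallyEq {V : VField n L} {U : Set L} (hU : IsOpen U)
    (hV : ContMDiffOn (𝓡 n) (𝓡 n).tangent ∞ (fun x => (⟨x, V x⟩ : TangentBundle (𝓡 n) L)) U)
    {x : L} (hx : x ∈ U) :
    ∃ W : VField n L, SmoothField W ∧ ∀ᶠ y in nhds x, W y = V y := by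
  obtain ⟨f, -, hf⟩ := (SmoothBumpFunction.nhds_basis_tsupport (I := 𝓡 n) x).mem_iff.1
    (hU.mem_nhds hx)
  refine ⟨(f : L → ℝ) • V,
    ContMDiffOn.smul_section_of_tsupport f.contMDiff.contMDiffOn hU hf hV, ?_⟩
  filter_upwards [f.eventuallyEq_one] with y hy
  simp only [Pi.smul_apply', hy, Pi.one_apply, one_smul]

theorem smoothField_of_smoothField_apply {A : (x : L) → Module.End ℝ (TangentSpace (𝓡 n) x)}
    (hA : ∀ V : VField n L, SmoothField V → SmoothField fun x => A x (V x))
    (hu : ∀ x, IsUnit (A x)) {W : VField n L}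
    (hW : SmoothField fun x => A x (W x)) : SmoothField W := by
  intro x
  let e := trivializationAt (EuclideanSpace ℝ (Fin n)) (TangentSpace (𝓡 n) : L → Type _) x
  let b := (EuclideanSpace.basisFun (Fin n) ℝ).toBasis
  have hx : x ∈ e.baseSet := FiberBundle.mem_baseSet_trivializationAt' x
  have hbase : ∀ᶠ y in nhds x, y ∈ e.baseSet := e.open_baseSet.mem_nhds hx
  let coeff (V : VField n L) (y : L) (i : Fin n) : ℝ := e.localFrameCoeff (𝓡 n) b i y (V y)
  have coeff_eq_repr {y : L} (hy : y ∈ e.baseSet) (V : VField n L) :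
      coeff V y = (e.basisAt b hy).repr (V y) :=
    funext fun i => e.localFrameCoeff_apply_of_mem_baseSet b hy V i
  let M (y : L) : Matrix (Fin n) (Fin n) ℝ := fun i j =>
    coeff (fun z => A z (e.localFrame b j z)) y i
  have M_eq_toMatrix {y : L} (hy : y ∈ e.baseSet) :
      M y = LinearMap.toMatrix (e.basisAt b hy) (e.basisAt b hy) (A y) := by
    ext i j
    rw [LinearMap.toMatrix_apply, ← e.localFrame_apply_of_mem_baseSet b hy]
    exact congrFun (coeff_eq_repr hy fun z => A z (e.localFrame b j z)) i
  have hM (i j) : ContMDiffAt (𝓡 n) 𝓘(ℝ, ℝ) ∞ (fun y => M y i j) x := by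
    obtain ⟨E, hE, hEj⟩ := exists_smoothField_eventuallyEq e.open_baseSet
      (e.contMDiffOn_localFrame_baseSet ∞ b j) hx
    refine (contMDiffAt_localFrameCoeff b hx (hA E hE x) i).congr_of_eventuallyEq ?_
    filter_upwards [hEj] with y hy
    simp only [M, coeff, LinearMap.piApply_apply, hy]
  refine (contMDiffAt_iff_localFrameCoeff b hx).2 <| contMDiffAt_of_mulVec_eventuallyEq hM
    (contMDiffAt_localFrameCoeff b hx (hW x)) (w := coeff W) ?_ ?_
  · filter_upwards [hbase] with y hy
    rw [M_eq_toMatrix hy, LinearMap.det_toMatrix]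
    exact (LinearMap.isUnit_det _ (hu y)).ne_zero
  · filter_upwards [hbase] with y hy
    rw [M_eq_toMatrix hy, coeff_eq_repr hy, LinearMap.toMatrix_mulVec_repr]
    exact (coeff_eq_repr hy fun z => A z (W z)).symm

end Inverse

/-! ### Sections and smooth endomorphism fields of a distribution -/

section Sections

variable {n : ℕ} {L : Type*} [TopologicalSpace L] [ChartedSpace (EuclideanSpace ℝ (Fin n)) L]
  {ξ : (x : L) → Submodule ℝ (TangentSpace (𝓡 n) x)} {A B : (x : L) → Module.End ℝ (ξ x)}
  {V W : VField n L}

theorem act_apply (A : (x : L) → Module.End ℝ (ξ x)) (hV : TangentTo ξ V) (x : L) :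
    act A V x = (A x ⟨V x, hV x⟩ : ξ x) := dif_pos (hV x)

theorem tangentTo_act (A : (x : L) → Module.End ℝ (ξ x)) (hV : TangentTo ξ V) :
    TangentTo ξ (act A V) := fun x => act_apply A hV x ▸ (A x _).2

theorem act_zero (hV : TangentTo ξ V) : act (0 : (x : L) → Module.End ℝ (ξ x)) V = 0 :=
  funext fun x => act_apply 0 hV x

theorem act_one (hV : TangentTo ξ V) : act (1 : (x : L) → Module.End ℝ (ξ x)) V = V :=
  funext fun x => act_apply 1 hV x

theorem act_add (hV : TangentTo ξ V) : act (A + B) V = act A V + act B V :=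
  funext fun x => by
    rw [Pi.add_apply, act_apply _ hV, act_apply _ hV, act_apply _ hV]
    rfl

theorem act_neg (hV : TangentTo ξ V) : act (-A) V = -act A V :=
  funext fun x => by
    rw [Pi.neg_apply, act_apply _ hV, act_apply _ hV]
    rfl

theorem act_mul (hV : TangentTo ξ V) : act (A * B) V = act A (act B V) :=
  funext fun x => by
    rw [act_apply _ hV, act_apply _ (tangentTo_act B hV)]
    simp only [act_apply _ hV]
    rfl

theorem act_map_add (A : (x : L) → Module.End ℝ (ξ x)) (hV : TangentTo ξ V)
    (hW : TangentTo ξ W) : act A (V + W) = act A V + act A W :=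
  funext fun x => by
    have hVW : TangentTo ξ (V + W) := fun x => add_mem (hV x) (hW x)
    rw [Pi.add_apply, act_apply _ hV, act_apply _ hW, act_apply _ hVW, ← Submodule.coe_add,
      ← map_add]
    rfl

theorem act_map_smul (A : (x : L) → Module.End ℝ (ξ x)) (a : ℝ) (hV : TangentTo ξ V) :
    act A (a • V) = a • act A V :=
  funext fun x => by
    have haV : TangentTo ξ (a • V) := fun x => (ξ x).smul_mem a (hV x)
    rw [Pi.smul_apply, act_apply _ hV, act_apply _ haV, ← Submodule.coe_smul, ← map_smul]
    rfl

variable [IsManifold (𝓡 n) ∞ L]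

/-- The space of smooth vector fields tangent to `ξ`. -/
def sections (ξ : (x : L) → Submodule ℝ (TangentSpace (𝓡 n) x)) : Submodule ℝ (VField n L) where
  carrier := {V | SmoothField V ∧ TangentTo ξ V}
  add_mem' hV hW := ⟨hV.1.add hW.1, fun x => add_mem (hV.2 x) (hW.2 x)⟩
  zero_mem' := ⟨SmoothField.zero, fun _ => zero_mem _⟩
  smul_mem' a _ hV := ⟨hV.1.const_smul a, fun x => Submodule.smul_mem _ a (hV.2 x)⟩

/-- The ring of smooth fields of endomorphisms of `ξ`. -/
def smoothEnds (ξ : (x : L) → Submodule ℝ (TangentSpace (𝓡 n) x)) :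
    Subring ((x : L) → Module.End ℝ (ξ x)) where
  carrier := {A | SmoothEnd A}
  zero_mem' V _ tV := by
    rw [act_zero tV]
    exact SmoothField.zero
  one_mem' V hV tV := by rwa [act_one tV]
  add_mem' hA hB V hV tV := by
    rw [act_add tV]
    exact (hA V hV tV).add (hB V hV tV)
  neg_mem' hA V hV tV := by
    rw [act_neg tV]
    exact (hA V hV tV).neg
  mul_mem' {A B} hA hB V hV tV := by
    rw [act_mul tV]
    exact hA _ (hB V hV tV) (tangentTo_act B tV)

/-- The action of smooth fields of endomorphisms of `ξ` on the sections of `ξ`. -/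
def actSections : smoothEnds ξ →+* Module.End ℝ (sections ξ) where
  toFun A :=
    { toFun V := ⟨act A.1 V, A.2 V V.2.1 V.2.2, tangentTo_act A.1 V.2.2⟩
      map_add' V W := Subtype.ext (act_map_add A.1 V.2.2 W.2.2)
      map_smul' a V := Subtype.ext (act_map_smul A.1 a V.2.2) }
  map_zero' := LinearMap.ext fun V => Subtype.ext (act_zero V.2.2)
  map_one' := LinearMap.ext fun V => Subtype.ext (act_one V.2.2)
  map_add' _ _ := LinearMap.ext fun V => Subtype.ext (act_add V.2.2)
  map_mul' _ _ := LinearMap.ext fun V => Subtype.ext (act_mul V.2.2)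

theorem coe_actSections (A : smoothEnds ξ) (V : sections ξ) :
    (actSections A V : VField n L) = act A.1 V := rfl

end Sections

/-! ### The splitting of the tangent bundle by a defining couple -/

section Splitting

variable {n : ℕ} {L : Type*} [TopologicalSpace L] [ChartedSpace (EuclideanSpace ℝ (Fin n)) L]
  [IsManifold (𝓡 n) ∞ L] {F : EndoDistribution n L} (c : DefiningCouple F.ξ) {x : L}

theorem coe_proj (v : TangentSpace (𝓡 n) x) :
    (proj c x v : TangentSpace (𝓡 n) x) = v - c.γ x v • c.X x := rfl

theorem γ_coe (v : F.ξ x) : c.γ x v = 0 := (c.ker_γ x v).1 v.2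

theorem proj_coe (v : F.ξ x) : proj c x v = v :=
  Subtype.ext (by rw [coe_proj, γ_coe, zero_smul, sub_zero])

theorem proj_X : proj c x (c.X x) = 0 :=
  Subtype.ext (by rw [coe_proj, c.γ_X, one_smul, sub_self, Submodule.coe_zero])

theorem SmoothField.sub_smul {α : OneForm n L} (hα : SmoothFormOn α univ) {X V : VField n L}
    (hX : SmoothField X) (hV : SmoothField V) :
    SmoothField fun x => V x - α x (V x) • X x :=
  hV.sub ((hα.contMDiff hV).smul_section hX)

/-- The extension of an endomorphism of `ξ_x` to the tangent space that fixes `X`. -/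
def extendEnd (x : L) : Module.End ℝ (F.ξ x) →* Module.End ℝ (TangentSpace (𝓡 n) x) where
  toFun A := (F.ξ x).subtype ∘ₗ A ∘ₗ proj c x +
    (c.γ x : TangentSpace (𝓡 n) x →ₗ[ℝ] ℝ).smulRight (c.X x)
  map_one' := LinearMap.ext fun v => sub_add_cancel v (c.γ x v • c.X x)
  map_mul' A B := LinearMap.ext fun v => by simp [proj_coe, proj_X, γ_coe, c.γ_X]

theorem extendEnd_apply (A : Module.End ℝ (F.ξ x)) (v : TangentSpace (𝓡 n) x) :
    extendEnd c x A v = (A (proj c x v) : TangentSpace (𝓡 n) x) + c.γ x v • c.X x := rfl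

theorem extendEnd_coe (A : Module.End ℝ (F.ξ x)) (v : F.ξ x) :
    extendEnd c x A v = (A v : TangentSpace (𝓡 n) x) := by
  rw [extendEnd_apply, proj_coe, γ_coe, zero_smul, add_zero]

theorem SmoothEnd.extendEnd {A : (x : L) → Module.End ℝ (F.ξ x)} (hA : SmoothEnd A)
    {V : VField n L} (hV : SmoothField V) :
    SmoothField fun x => LeviFlat.extendEnd c x (A x) (V x) := by
  let πV : VField n L := fun x => proj c x (V x)
  have hπV : TangentTo F.ξ πV := fun x => (proj c x (V x)).2
  have extendEnd_eq_add : (fun x => LeviFlat.extendEnd c x (A x) (V x)) =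
      act A πV + fun x => c.γ x (V x) • c.X x := by
    ext1 x
    rw [Pi.add_apply, act_apply A hπV, extendEnd_apply]
  rw [extendEnd_eq_add]
  exact (hA _ (SmoothField.sub_smul c.smooth_γ c.smooth_X hV) hπV).add
    ((c.smooth_γ.contMDiff hV).smul_section c.smooth_X)

include c in
theorem SmoothEnd.inverse [T2Space L] {A : (x : L) → Module.End ℝ (F.ξ x)} (hA : SmoothEnd A)
    (hu : ∀ x, IsUnit (A x)) : SmoothEnd fun x => Ring.inverse (A x) := by
  intro V hV tV
  refine smoothField_of_smoothField_apply (A := fun x => LeviFlat.extendEnd c x (A x))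
    (fun W hW => hA.extendEnd c hW) (fun x => (hu x).map (LeviFlat.extendEnd c x)) ?_
  have extendEnd_act_inverse :
      (fun x => LeviFlat.extendEnd c x (A x) (act (fun x => Ring.inverse (A x)) V x)) = V := by
    ext1 x
    rw [act_apply _ tV, extendEnd_coe, ← Module.End.mul_apply, Ring.mul_inverse_cancel _ (hu x),
      Module.End.one_apply]
  rwa [extendEnd_act_inverse]

include c in
theorem isUnit_smoothEnds [T2Space L] {A : smoothEnds F.ξ} (hu : ∀ x, IsUnit (A.1 x)) :
    IsUnit A :=
  ⟨⟨A, ⟨_, SmoothEnd.inverse c A.2 hu⟩,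
    Subtype.ext (funext fun x => Ring.mul_inverse_cancel _ (hu x)),
    Subtype.ext (funext fun x => Ring.inverse_mul_cancel _ (hu x))⟩, rfl⟩

end Splitting

/-! ### Distributions transverse to the vector field of a defining couple -/

section Transverse

variable {n : ℕ} {L : Type*} [TopologicalSpace L] [ChartedSpace (EuclideanSpace ℝ (Fin n)) L]
  [IsManifold (𝓡 n) ∞ L] {F G G' : EndoDistribution n L} {c : DefiningCouple F.ξ}
  {α β : OneForm n L} {ξ' : (x : L) → Submodule ℝ (TangentSpace (𝓡 n) x)} {V W : VField n L}

/-- `ξ'` is the distribution `ξ_α = ker (γ + α)`, for a one-form `α` with `α (X) = 0`. It is a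
predicate on `ξ'` because the distributions that occur are equal to `ker (γ + α)` but not by
definition. -/
structure DefinedBy (c : DefiningCouple F.ξ) (α : OneForm n L)
    (ξ' : (x : L) → Submodule ℝ (TangentSpace (𝓡 n) x)) : Prop where
  apply_X : ∀ x, α x (c.X x) = 0
  mem_iff : ∀ x (v : TangentSpace (𝓡 n) x), v ∈ ξ' x ↔ c.γ x v + α x v = 0

theorem omegaAt_apply {x : L} (v : F.ξ x) :
    omegaAt c α x v = (v : TangentSpace (𝓡 n) x) - α x v • c.X x := rfl

theorem proj_omegaAt {x : L} (v : F.ξ x) : proj c x (omegaAt c α x v) = v := by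
  rw [omegaAt_apply, map_sub, map_smul, proj_X, smul_zero, sub_zero, proj_coe]

namespace DefinedBy

theorem X_notMem (h : DefinedBy c α ξ') (x : L) : c.X x ∉ ξ' x := by
  simp [h.mem_iff, h.apply_X, c.γ_X]

theorem unique (h : DefinedBy c α ξ') (h' : DefinedBy c β ξ') : α = β := by
  ext x v
  have hv : v - (c.γ x v + α x v) • c.X x ∈ ξ' x := by simp [h.mem_iff, h.apply_X, c.γ_X]
  have := (h'.mem_iff x _).1 hv
  simp only [map_sub, map_smul, h'.apply_X, c.γ_X, smul_eq_mul] at this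
  linarith

theorem omegaAt_mem (h : DefinedBy c α ξ') {x : L} (v : F.ξ x) : omegaAt c α x v ∈ ξ' x := by
  simp [h.mem_iff, omegaAt_apply, h.apply_X, c.γ_X, γ_coe]

theorem omegaAt_proj (h : DefinedBy c α ξ') {x : L} (v : ξ' x) :
    omegaAt c α x (proj c x v) = v := by
  have : α x v = -c.γ x v := (neg_eq_of_add_eq_zero_right ((h.mem_iff x v).1 v.2)).symm
  simp [omegaAt_apply, coe_proj, h.apply_X, this]

/-- The projection along `X`, as an isomorphism from `ξ_α` to `ξ`; its inverse is `ω_α`. -/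
def projEquiv (h : DefinedBy c α ξ') (x : L) : ξ' x ≃ₗ[ℝ] F.ξ x :=
  LinearEquiv.ofLinearMap (proj c x ∘ₗ (ξ' x).subtype)
    ((omegaAt c α x).codRestrict (ξ' x) h.omegaAt_mem)
    (LinearMap.ext proj_omegaAt) (LinearMap.ext fun v => Subtype.ext (h.omegaAt_proj v))

/-- The field of endomorphisms `ω_α⁻¹ K ω_α` of `ξ`, for a field `K` of endomorphisms of
`ξ_α`. -/
def conj (h : DefinedBy c α ξ') (K : (x : L) → Module.End ℝ (ξ' x)) (x : L) :
    Module.End ℝ (F.ξ x) :=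
  (h.projEquiv x).conjAlgEquiv ℝ (K x)

variable {K : (x : L) → Module.End ℝ (ξ' x)}

theorem conj_proj (h : DefinedBy c α ξ') {x : L} (v : ξ' x) :
    h.conj K x (proj c x v) = proj c x (K x v) :=
  congrArg (fun w => h.projEquiv x (K x w)) ((h.projEquiv x).symm_apply_apply v)

theorem omegaAt_conj (h : DefinedBy c α ξ') {x : L} (v : F.ξ x) :
    omegaAt c α x (h.conj K x v) = K x ⟨omegaAt c α x v, h.omegaAt_mem v⟩ :=
  h.omegaAt_proj _

theorem conj_mul_self_eq_neg_one_iff (h : DefinedBy c α ξ') {x : L} :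
    h.conj K x * h.conj K x = -1 ↔ K x * K x = -1 := by
  rw [conj, ← map_mul, ← map_one ((h.projEquiv x).conjAlgEquiv ℝ), ← map_neg,
    EmbeddingLike.apply_eq_iff_eq]

theorem eq_of_conj_eq (h : DefinedBy c α G.ξ) (h' : DefinedBy c α G'.ξ)
    (hJ : h.conj G.J = h'.conj G'.J) : G = G' := by
  obtain ⟨ξ, J⟩ := G
  obtain ⟨ξ', J'⟩ := G'
  obtain rfl : ξ = ξ' := by
    ext x v
    exact (h.mem_iff x v).trans (h'.mem_iff x v).symm
  exact congrArg _ (funext fun x => ((h.projEquiv x).conjAlgEquiv ℝ).injective (congrFun hJ x))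

theorem closeTo_iff_isUnit (h : DefinedBy c α G.ξ) :
    CloseTo c G ↔ ∀ x, IsUnit (F.J x + h.conj G.J x) := by
  refine forall_congr' fun x => (and_iff_right (h.X_notMem x)).trans ?_
  have : FiniteDimensional ℝ (TangentSpace (𝓡 n) x) :=
    inferInstanceAs (FiniteDimensional ℝ (EuclideanSpace ℝ (Fin n)))
  rw [LinearMap.isUnit_iff_ker_eq_bot, LinearMap.ker_eq_bot',
    (h.projEquiv x).symm.surjective.forall]
  refine forall_congr' fun v => imp_congr ?_ (h.projEquiv x).symm.map_eq_zero_iff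
  rw [← h.conj_proj]
  change F.J x (proj c x (omegaAt c α x v)) + h.conj G.J x (proj c x (omegaAt c α x v)) = 0 ↔ _
  rw [proj_omegaAt, LinearMap.add_apply]

theorem involutive_iff (h : DefinedBy c α ξ') (hF : Involutive F.ξ) (hα : SmoothFormOn α univ) :
    Involutive ξ' ↔ EqAlpha c α := by
  have flat := (involutive_iff_curvature_eq_zero c.smooth_X c.smooth_γ c.γ_X c.ker_γ).1 hF
  rw [involutive_iff_curvature_eq_zero c.smooth_X (c.smooth_γ.add hα)
    (fun x => by simp [c.γ_X, h.apply_X]) h.mem_iff]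
  refine forall₅_congr fun V W hV hW x => ?_
  rw [curvature_add c.smooth_γ hα hV hW, flat V W hV hW, zero_add]

theorem smoothCodimOne (h : DefinedBy c α ξ') (hα : SmoothFormOn α univ) : SmoothCodimOne ξ' :=
  fun x => ⟨univ, isOpen_univ, mem_univ x, c.γ + α, c.smooth_γ.add hα, fun y _ =>
    ⟨fun h0 => h.X_notMem y <| (h.mem_iff y _).2 <|
      (congrArg (· (c.X y)) h0 : (c.γ + α) y (c.X y) = 0), h.mem_iff y⟩⟩

theorem omega_omegaInv (h : DefinedBy c α ξ') (V : VField n L) :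
    omega c α (omegaInv c α V) = V := by
  ext1 x
  simp [omega, omegaInv, h.apply_X]

theorem omegaInv_omega (h : DefinedBy c α ξ') (V : VField n L) :
    omegaInv c α (omega c α V) = V := by
  ext1 x
  simp [omega, omegaInv, h.apply_X]

theorem omega_mem_iff (h : DefinedBy c α ξ') {x : L} : omega c α V x ∈ ξ' x ↔ V x ∈ F.ξ x := by
  simp [h.mem_iff, c.ker_γ, omega, h.apply_X, c.γ_X]

theorem tangentTo_omega_iff (h : DefinedBy c α ξ') :
    TangentTo ξ' (omega c α V) ↔ TangentTo F.ξ V :=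
  forall_congr' fun _ => h.omega_mem_iff

theorem tangentTo_omegaInv (h : DefinedBy c α ξ') (hV : TangentTo ξ' V) :
    TangentTo F.ξ (omegaInv c α V) := by
  rwa [← h.tangentTo_omega_iff, h.omega_omegaInv]

theorem omegaInv_apply_eq_proj (h : DefinedBy c α ξ') (hV : TangentTo ξ' V) (x : L) :
    omegaInv c α V x = proj c x (V x) := by
  have : α x (V x) = -c.γ x (V x) :=
    (neg_eq_of_add_eq_zero_right ((h.mem_iff x _).1 (hV x))).symm
  rw [omegaInv, coe_proj, this, neg_smul, sub_eq_add_neg]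

/-- The linear automorphism `ω_α` of the space of vector fields. -/
def omegaEquiv (h : DefinedBy c α ξ') : VField n L ≃ₗ[ℝ] VField n L where
  toFun := omega c α
  invFun := omegaInv c α
  left_inv := h.omegaInv_omega
  right_inv := h.omega_omegaInv
  map_add' V W := funext fun x => by
    simp only [omega, Pi.add_apply, map_add, add_smul]
    abel
  map_smul' a V := funext fun x => by
    simp only [omega, Pi.smul_apply, map_smul, smul_eq_mul, mul_smul, smul_sub, RingHom.id_apply]

theorem omega_act_conj (h : DefinedBy c α ξ') (V : VField n L) :
    omega c α (act (h.conj K) V) = act K (omega c α V) := by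
  ext1 x
  by_cases hV : V x ∈ F.ξ x
  · rw [act, dif_pos (h.omega_mem_iff.2 hV), omega, act, dif_pos hV]
    exact h.omegaAt_conj ⟨V x, hV⟩
  · rw [act, dif_neg (mt h.omega_mem_iff.1 hV), omega, act, dif_neg hV, map_zero, zero_smul,
      sub_zero]

theorem nijenhuis_omega (h : DefinedBy c α ξ') (V W : VField n L) :
    nijenhuis lie (act K) (omega c α V) (omega c α W) =
      omega c α (nijenhuis (lieAlpha c α) (act (h.conj K)) V W) :=
  (map_nijenhuis (h.omegaEquiv : VField n L →ₗ[ℝ] VField n L) (fun _ _ => h.omega_omegaInv _)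
    h.omega_act_conj V W).symm

end DefinedBy

theorem SmoothField.omega (hα : SmoothFormOn α univ) (hV : SmoothField V) :
    SmoothField (LeviFlat.omega c α V) :=
  SmoothField.sub_smul hα c.smooth_X hV

theorem SmoothField.omegaInv (hα : SmoothFormOn α univ) (hV : SmoothField V) :
    SmoothField (LeviFlat.omegaInv c α V) :=
  hV.add ((hα.contMDiff hV).smul_section c.smooth_X)

namespace DefinedBy

variable {K : (x : L) → Module.End ℝ (ξ' x)}

theorem forall_tangentTo_iff (h : DefinedBy c α ξ') (hα : SmoothFormOn α univ)
    {P : VField n L → Prop} :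
    (∀ V, SmoothField V → TangentTo ξ' V → P V) ↔
      ∀ V, SmoothField V → TangentTo F.ξ V → P (omega c α V) := by
  refine ⟨fun H V hV tV => H _ (hV.omega hα) (h.tangentTo_omega_iff.2 tV), fun H V hV tV => ?_⟩
  rw [← h.omega_omegaInv V]
  exact H _ (hV.omegaInv hα) (h.tangentTo_omegaInv tV)

theorem smoothEnd_conj_iff (h : DefinedBy c α ξ') (hα : SmoothFormOn α univ) :
    SmoothEnd (h.conj K) ↔ SmoothEnd K := by
  refine Iff.trans ?_ (h.forall_tangentTo_iff hα (P := fun V => SmoothField (act K V))).symm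
  refine forall₃_congr fun V hV tV => ?_
  rw [← h.omega_act_conj]
  refine ⟨fun H => H.omega hα, fun H => ?_⟩
  rw [← h.omegaInv_omega (act (h.conj K) V)]
  exact H.omegaInv hα

theorem isLeviFlat_iff (h : DefinedBy c α G.ξ) (hα : SmoothFormOn α univ)
    (hF : Involutive F.ξ) :
    IsLeviFlat G ↔ EqAlpha c α ∧ SmoothEnd (h.conj G.J) ∧
      (∀ x, h.conj G.J x * h.conj G.J x = -1) ∧
      ∀ V W, SmoothField V → SmoothField W → TangentTo F.ξ V → TangentTo F.ξ W →
        nijenhuis (lieAlpha c α) (act (h.conj G.J)) V W = 0 := by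
  have integrable_iff : (∀ V W, SmoothField V → SmoothField W → TangentTo G.ξ V →
      TangentTo G.ξ W → nijenhuis lie (act G.J) V W = 0) ↔
      ∀ V W, SmoothField V → SmoothField W → TangentTo F.ξ V → TangentTo F.ξ W →
        nijenhuis (lieAlpha c α) (act (h.conj G.J)) V W = 0 := by
    have reorder {P Q : VField n L → Prop} {N : VField n L → VField n L → Prop} :
        (∀ V W, P V → P W → Q V → Q W → N V W) ↔
          ∀ V, P V → Q V → ∀ W, P W → Q W → N V W := by grind
    rw [reorder, reorder, h.forall_tangentTo_iff hα]
    refine forall₃_congr fun V _ _ => ?_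
    rw [h.forall_tangentTo_iff hα]
    refine forall₃_congr fun W _ _ => ?_
    rw [h.nijenhuis_omega]
    exact h.omegaEquiv.map_eq_zero_iff
  rw [← h.involutive_iff hF hα, h.smoothEnd_conj_iff hα, ← integrable_iff]
  simp only [h.conj_mul_self_eq_neg_one_iff]
  exact ⟨fun H => ⟨H.involutive, H.smooth_J, H.J_sq, H.integrable⟩,
    fun ⟨inv, smooth, sq, int⟩ => ⟨h.smoothCodimOne hα, inv, smooth, sq, int⟩⟩

end DefinedBy

end Transverse

/-! ### The bracket `[·,·]_α` and the second Maurer-Cartan equation -/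

section LieAlpha

variable {n : ℕ} {L : Type*} [TopologicalSpace L] [ChartedSpace (EuclideanSpace ℝ (Fin n)) L]
  [IsManifold (𝓡 n) ∞ L] {F : EndoDistribution n L} {c : DefiningCouple F.ξ}
  {α : OneForm n L} {ξ' : (x : L) → Submodule ℝ (TangentSpace (𝓡 n) x)} {V W : VField n L}

theorem lieAlpha_swap (V W : VField n L) : lieAlpha c α V W = -lieAlpha c α W V := by
  ext1 x
  simp only [lieAlpha, omegaInv, Pi.neg_apply, lie_swap (omega c α V), map_neg]
  module

/-- The Lie bracket of sections of an involutive distribution. -/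
def lieSections (hξ : Involutive ξ') : sections ξ' →ₗ[ℝ] sections ξ' →ₗ[ℝ] sections ξ' :=
  LinearMap.mk₂ ℝ
    (fun V W => ⟨lie V W, V.2.1.lie W.2.1, hξ V W V.2.1 W.2.1 V.2.2 W.2.2⟩)
    (fun V V' _ => Subtype.ext (lie_add_left V.2.1 V'.2.1))
    (fun a V _ => Subtype.ext (lie_const_smul_left a V.2.1))
    (fun _ W W' => Subtype.ext (lie_add_right W.2.1 W'.2.1))
    (fun a _ W => Subtype.ext (lie_const_smul_right a W.2.1))

theorem forall_sections_iff {P : VField n L → VField n L → Prop} :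
    (∀ V W, SmoothField V → SmoothField W → TangentTo ξ' V → TangentTo ξ' W → P V W) ↔
      ∀ V W : sections ξ', P V W :=
  ⟨fun H V W => H V W V.2.1 W.2.1 V.2.2 W.2.2,
    fun H V W hV hW tV tW => H ⟨V, hV, tV⟩ ⟨W, hW, tW⟩⟩

namespace DefinedBy

/-- The isomorphism `ω_α` from the sections of `ξ` to the sections of `ξ_α`. -/
def sectionsEquiv (h : DefinedBy c α ξ') (hα : SmoothFormOn α univ) :
    sections F.ξ ≃ₗ[ℝ] sections ξ' :=
  h.omegaEquiv.ofSubmodules _ _ <| by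
    ext V
    refine ⟨?_, fun hV => ⟨omegaInv c α V, ⟨hV.1.omegaInv hα, h.tangentTo_omegaInv hV.2⟩,
      h.omega_omegaInv V⟩⟩
    rintro ⟨V, hV, rfl⟩
    exact ⟨hV.1.omega hα, h.tangentTo_omega_iff.2 hV.2⟩

/-- The bracket `[·,·]_α` on the sections of `ξ`. -/
def bracket (h : DefinedBy c α ξ') (hα : SmoothFormOn α univ) (hξ' : Involutive ξ') :
    sections F.ξ →ₗ[ℝ] sections F.ξ →ₗ[ℝ] sections F.ξ :=
  ((lieSections hξ').compl₁₂ (h.sectionsEquiv hα : sections F.ξ →ₗ[ℝ] sections ξ')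
    (h.sectionsEquiv hα : sections F.ξ →ₗ[ℝ] sections ξ')).compr₂
      ((h.sectionsEquiv hα).symm : sections ξ' →ₗ[ℝ] sections F.ξ)

theorem coe_bracket (h : DefinedBy c α ξ') (hα : SmoothFormOn α univ) (hξ' : Involutive ξ')
    (V W : sections F.ξ) : (h.bracket hα hξ' V W : VField n L) = lieAlpha c α V W := rfl

theorem lieAlpha_apply (h : DefinedBy c α ξ') (hα : SmoothFormOn α univ) (hξ' : Involutive ξ')
    (hF : Involutive F.ξ) (hV : V ∈ sections F.ξ) (hW : W ∈ sections F.ξ) (x : L) :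
    lieAlpha c α V W x = lie V W x - α x (W x) • tForm c V x + α x (V x) • tForm c W x := by
  have proj_lie : (proj c x (lie V W x) : TangentSpace (𝓡 n) x) = lie V W x :=
    congrArg Subtype.val (proj_coe c ⟨_, hF V W hV.1 hW.1 hV.2 hW.2 x⟩)
  have tangent_lie : TangentTo ξ' (lie (omega c α V) (omega c α W)) :=
    hξ' _ _ (hV.1.omega hα) (hW.1.omega hα) (h.tangentTo_omega_iff.2 hV.2)
      (h.tangentTo_omega_iff.2 hW.2)
  have lie_omega := lie_sub_smul_sub_smul c.smooth_X (hα.contMDiff hV.1) (hα.contMDiff hW.1)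
    hV.1 hW.1 x
  calc lieAlpha c α V W x
      = proj c x (lie (omega c α V) (omega c α W) x) := h.omegaInv_apply_eq_proj tangent_lie x
    _ = _ := (congrArg (fun v => (proj c x v : TangentSpace (𝓡 n) x)) lie_omega).trans <| by
      simp only [map_add, map_sub, map_smul, proj_X, smul_zero, add_zero, Submodule.coe_add,
        Submodule.coe_sub, Submodule.coe_smul, proj_lie]
      rfl

theorem nijenhuis_lieAlpha (h : DefinedBy c α ξ') (hα : SmoothFormOn α univ)
    (hξ' : Involutive ξ') (hF : IsLeviFlat F) (hV : V ∈ sections F.ξ) (hW : W ∈ sections F.ξ) :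
    nijenhuis (lieAlpha c α) (act F.J) V W = -((4 : ℝ) • wedgeH c α V W) := by
  ext1 x
  let j : Module.End ℝ (TangentSpace (𝓡 n) x) := (F.ξ x).subtype ∘ₗ F.J x ∘ₗ proj c x
  have act_eq {Z : VField n L} (hZ : TangentTo F.ξ Z) : act F.J Z x = j (Z x) :=
    (act_apply F.J hZ x).trans
      (congrArg (fun v => (F.J x v : TangentSpace (𝓡 n) x)) (proj_coe c ⟨Z x, hZ x⟩).symm)
  have j_j {Z : VField n L} (hZ : TangentTo F.ξ Z) : j (j (Z x)) = -Z x := by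
    rw [← act_eq hZ, ← act_eq (tangentTo_act F.J hZ), ← act_mul hZ, act_apply _ hZ,
      Pi.mul_apply, hF.J_sq]
    rfl
  have hJV : act F.J V ∈ sections F.ξ := ⟨hF.smooth_J V hV.1 hV.2, tangentTo_act F.J hV.2⟩
  have hJW : act F.J W ∈ sections F.ξ := ⟨hF.smooth_J W hW.1 hW.2, tangentTo_act F.J hW.2⟩
  have tangent_lie {A B : VField n L} (hA : A ∈ sections F.ξ) (hB : B ∈ sections F.ξ) :
      TangentTo F.ξ (lie A B) := hF.involutive _ _ hA.1 hB.1 hA.2 hB.2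
  have tangent_lieAlpha {A B : VField n L} (hA : A ∈ sections F.ξ) (hB : B ∈ sections F.ξ) :
      TangentTo F.ξ (lieAlpha c α A B) := (h.bracket hα hξ' ⟨A, hA⟩ ⟨B, hB⟩).2.2
  have tangent_tForm (Z : VField n L) : TangentTo F.ξ (tForm c Z) := fun y =>
    (proj c y (lie Z c.X y)).2
  have tangent_hForm (Z : VField n L) : TangentTo F.ξ (hForm c Z) := fun y =>
    Submodule.smul_mem _ _ (add_mem (tangent_tForm Z y) (tangentTo_act F.J (tangent_tForm _) y))
  have lie_J_J : lie (act F.J V) (act F.J W) x =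
      lie V W x + j (lie (act F.J V) W x) + j (lie V (act F.J W) x) := by
    have := congrFun (hF.integrable V W hV.1 hW.1 hV.2 hW.2) x
    simp only [nijenhuis, Pi.sub_apply, act_eq (tangent_lie hJV hW),
      act_eq (tangent_lie hV hJW), Pi.zero_apply] at this
    rw [sub_sub, sub_sub, sub_eq_zero] at this
    rw [this]
    abel
  simp only [nijenhuis, wedgeH, zeroOnePart, Pi.sub_apply, Pi.neg_apply, Pi.smul_apply,
    act_eq (tangent_lieAlpha hJV hW), act_eq (tangent_lieAlpha hV hJW), act_eq (tangent_hForm _),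
    h.lieAlpha_apply hα hξ' hF.involutive, hV, hW, hJV, hJW, lie_J_J]
  simp only [hForm, Pi.smul_apply, Pi.add_apply, act_eq (tangent_tForm _), map_smul, map_add,
    map_sub, j_j (tangent_tForm _)]
  module

theorem coe_nijenhuis_bracket (h : DefinedBy c α ξ') (hα : SmoothFormOn α univ)
    (hξ' : Involutive ξ') (A : smoothEnds F.ξ) (V W : sections F.ξ) :
    (sections F.ξ).subtype (nijenhuis (h.bracket hα hξ' · ·) (actSections A) V W) =
      nijenhuis (lieAlpha c α) (act A.1) V W := by
  rw [map_nijenhuis _ (h.coe_bracket hα hξ') (coe_actSections A)]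
  rfl

theorem coe_maurerCartan_bracket (h : DefinedBy c α ξ') (hα : SmoothFormOn α univ)
    (hξ' : Involutive ξ') (A B : smoothEnds F.ξ) (V W : sections F.ξ) :
    (sections F.ξ).subtype (dbarEnd (h.bracket hα hξ' · ·) (actSections A) (actSections B) V W
        + (1 / 2 : ℝ) • sDoubleBracket (h.bracket hα hξ' · ·) (actSections A) (actSections B) V W) =
      dbarEnd (lieAlpha c α) (act A.1) (act B.1) V W
        + (1 / 2 : ℝ) • sDoubleBracket (lieAlpha c α) (act A.1) (act B.1) V W := by
  rw [map_add, map_smul,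
    map_dbarEnd _ (h.coe_bracket hα hξ') (coe_actSections A) (coe_actSections B),
    map_sDoubleBracket _ (h.coe_bracket hα hξ') (coe_actSections A) (coe_actSections B)]
  rfl

theorem eqS_iff_nijenhuis [T2Space L] (h : DefinedBy c α ξ') (hα : SmoothFormOn α univ)
    (hξ' : Involutive ξ') (hF : IsLeviFlat F) {S K : (x : L) → Module.End ℝ (F.ξ x)}
    (hS : SmoothEnd S) (hSJ : ∀ x, S x * F.J x = -(F.J x * S x)) (hu : ∀ x, IsUnit (1 + S x))
    (hK : SmoothEnd K) (hSK : ∀ x, SemiconjBy (1 + S x) (F.J x) (K x)) :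
    EqS c α S ↔ ∀ V W, SmoothField V → SmoothField W → TangentTo F.ξ V → TangentTo F.ξ W →
        nijenhuis (lieAlpha c α) (act K) V W = 0 := by
  let J' : smoothEnds F.ξ := ⟨F.J, hF.smooth_J⟩
  let S' : smoothEnds F.ξ := ⟨S, hS⟩
  let K' : smoothEnds F.ξ := ⟨K, hK⟩
  have hJ' : J' * J' = -1 := Subtype.ext (funext hF.J_sq)
  have hS' : S' * J' = -(J' * S') := Subtype.ext (funext hSJ)
  have hu' : IsUnit (1 + S') := isUnit_smoothEnds c hu
  have hK' : SemiconjBy (1 + S') J' K' := Subtype.ext (funext hSK)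
  have nijenhuis_iff := nijenhuis_eq_zero_iff_maurerCartan (br := h.bracket hα hξ')
    (fun V W => Subtype.ext (lieAlpha_swap V.1 W.1)) actSections hJ' hS' hu' hK'
  simp only [← (sections F.ξ).injective_subtype.eq_iff, map_smul, map_zero,
    h.coe_nijenhuis_bracket, h.coe_maurerCartan_bracket] at nijenhuis_iff
  rw [forall_sections_iff, EqS, forall_sections_iff]
  refine Iff.trans (forall₂_congr fun V W => ?_) nijenhuis_iff.symm
  rw [h.nijenhuis_lieAlpha hα hξ' hF V.2 W.2, ← smul_neg,
    (smul_right_injective _ four_ne_zero).eq_iff, eq_comm]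

end DefinedBy

end LieAlpha

/-! ### The structures defined by the pairs `(α, S)` -/

section Normalize

variable {n : ℕ} {L : Type*} [TopologicalSpace L] [ChartedSpace (EuclideanSpace ℝ (Fin n)) L]
  {X : VField n L} {θ η : OneForm n L} {x : L}

/-- The multiple of a one-form `θ` with value `1` on `X`. It is `0` at the points where
`θ (X) = 0`. -/
def normalizeForm (X : VField n L) (θ : OneForm n L) : OneForm n L :=
  fun x => (θ x (X x))⁻¹ • θ x

theorem normalizeForm_apply_self (hθ : θ x (X x) ≠ 0) : normalizeForm X θ x (X x) = 1 := by
  simp [normalizeForm, hθ]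

theorem normalizeForm_apply_eq_zero_iff (hθ : θ x (X x) ≠ 0)
    (v : TangentSpace (𝓡 n) x) : normalizeForm X θ x v = 0 ↔ θ x v = 0 := by
  simp [normalizeForm, hθ]

theorem normalizeForm_congr (hθ : θ x (X x) ≠ 0) (hη : η x (X x) ≠ 0)
    (h : ∀ v, θ x v = 0 → η x v = 0) :
    normalizeForm X θ x = normalizeForm X η x := by
  ext v
  have : normalizeForm X η x (v - normalizeForm X θ x v • X x) = 0 := by
    rw [normalizeForm_apply_eq_zero_iff hη]
    refine h _ ((normalizeForm_apply_eq_zero_iff hθ _).1 ?_)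
    simp [normalizeForm_apply_self hθ]
  simpa [normalizeForm_apply_self hη, sub_eq_zero, eq_comm (a := normalizeForm X θ x v)] using this

end Normalize

section Deform

variable {n : ℕ} {L : Type*} [TopologicalSpace L] [ChartedSpace (EuclideanSpace ℝ (Fin n)) L]
  [IsManifold (𝓡 n) ∞ L] {F G : EndoDistribution n L} {c : DefiningCouple F.ξ}
  {p : ZOne c × ZeroOneForm F}

theorem definedBy_deform (p : ZOne c × ZeroOneForm F) : DefinedBy c p.1.1 (deform c p).ξ :=
  ⟨p.1.2.2, fun _ _ => Iff.rfl⟩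

theorem conj_deform (p : ZOne c × ZeroOneForm F) :
    (definedBy_deform p).conj (deform c p).J = twist p.2 := by
  ext1 x
  refine LinearMap.ext fun v => ?_
  change proj c x (omegaAt c p.1.1 x (twist p.2 x (proj c x (omegaAt c p.1.1 x v)))) = _
  rw [proj_omegaAt, proj_omegaAt]

theorem deform_eq_iff (hu : InvertibleS p.2) (h : DefinedBy c p.1.1 G.ξ) :
    deform c p = G ↔ ∀ x, SemiconjBy (1 + p.2.1 x) (F.J x) (h.conj G.J x) := by
  have semiconj_iff (K : (x : L) → Module.End ℝ (F.ξ x)) :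
      (∀ x, SemiconjBy (1 + p.2.1 x) (F.J x) (K x)) ↔ twist p.2 = K :=
    (forall_congr' fun x => (semiconjBy_iff_eq_mul_inverse (hu x)).trans eq_comm).trans
      funext_iff.symm
  rw [semiconj_iff, ← conj_deform]
  refine ⟨?_, (definedBy_deform p).eq_of_conj_eq h⟩
  rintro rfl
  rfl

theorem semiconjBy_twist (hu : InvertibleS p.2) (x : L) :
    SemiconjBy (1 + p.2.1 x) (F.J x) (twist p.2 x) :=
  (semiconjBy_iff_eq_mul_inverse (hu x)).2 rfl

theorem isLeviFlat_deform_iff [T2Space L] (hF : IsLeviFlat F) (hu : InvertibleS p.2) :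
    IsLeviFlat (deform c p) ↔ p ∈ MC c := by
  let S : smoothEnds F.ξ := ⟨p.2.1, p.2.2.1⟩
  have smooth_twist : SmoothEnd (twist p.2) :=
    mul_mem (mul_mem (1 + S).2 hF.smooth_J) (SmoothEnd.inverse c (1 + S).2 hu)
  have twist_sq (x : L) : twist p.2 x * twist p.2 x = -1 :=
    mul_self_eq_neg_one_of_semiconjBy (hF.J_sq x) (hu x) (semiconjBy_twist hu x)
  rw [(definedBy_deform p).isLeviFlat_iff p.1.2.1 hF.involutive, conj_deform,
    and_iff_right smooth_twist, and_iff_right twist_sq]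
  refine and_congr_right fun hα => ?_
  have involutive := ((definedBy_deform p).involutive_iff hF.involutive p.1.2.1).2 hα
  exact ((definedBy_deform p).eqS_iff_nijenhuis p.1.2.1 involutive hF p.2.2.1 p.2.2.2 hu
    smooth_twist (semiconjBy_twist hu)).symm

theorem deform_zero (hα : ∀ x, p.1.1 x = 0) (hS : ∀ x, p.2.1 x = 0) : deform c p = F := by
  have h : DefinedBy c p.1.1 F.ξ := ⟨p.1.2.2, fun x v => by simp [hα, c.ker_γ]⟩
  refine (deform_eq_iff (fun x => by simp [hS]) h).2 fun x => ?_
  have conj_J : h.conj F.J x = F.J x := LinearMap.ext fun v => by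
    simpa only [proj_coe] using h.conj_proj v
  rw [hS, add_zero, conj_J]
  exact SemiconjBy.one_left _

theorem closeTo_deform (hJ : ∀ x, F.J x * F.J x = -1) (hu : InvertibleS p.2) :
    CloseTo c (deform c p) := by
  rw [(definedBy_deform p).closeTo_iff_isUnit, conj_deform]
  exact fun x => isUnit_add_of_semiconjBy (isUnit_two_of_algebra ℝ) (hJ x) (p.2.2.2 x) (hu x)
    (semiconjBy_twist hu x)

theorem injOn_deform (hJ : ∀ x, F.J x * F.J x = -1) :
    InjOn (deform c) {p | InvertibleS p.2} := by
  rintro ⟨α, S⟩ hS ⟨β, Q⟩ hQ hSQ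
  have h : DefinedBy c α.1 (deform c (β, Q)).ξ := hSQ ▸ definedBy_deform (α, S)
  obtain rfl : α = β := Subtype.ext (h.unique (definedBy_deform (β, Q)))
  have semiconj_S := (deform_eq_iff hS h).1 hSQ
  have semiconj_Q := (deform_eq_iff hQ h).1 rfl
  have S_eq_Q : S.1 = Q.1 := funext fun x =>
    (cayley_eq_of_semiconjBy (isUnit_two_of_algebra ℝ) (hJ x) (S.2.2 x) (hS x)
      (semiconj_S x)).symm.trans
      (cayley_eq_of_semiconjBy (isUnit_two_of_algebra ℝ) (hJ x) (Q.2.2 x) (hQ x) (semiconj_Q x))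
  exact Prod.ext rfl (Subtype.ext S_eq_Q)

theorem SmoothFormOn.normalizeForm {X : VField n L} {θ : OneForm n L} {U : Set L}
    (hX : SmoothField X) (hθ : SmoothFormOn θ U) (hne : ∀ x ∈ U, θ x (X x) ≠ 0) :
    SmoothFormOn (normalizeForm X θ) U :=
  fun V hV => ((hθ X hX).inv₀ hne).mul (hθ V hV)

theorem definedBy_normalizeForm_sub {ξ' : (x : L) → Submodule ℝ (TangentSpace (𝓡 n) x)}
    {θ : OneForm n L} (hX : ∀ x, θ x (c.X x) ≠ 0) (hker : ∀ x v, v ∈ ξ' x ↔ θ x v = 0) :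
    DefinedBy c (normalizeForm c.X θ - c.γ) ξ' where
  apply_X x := by simp [normalizeForm_apply_self (hX x), c.γ_X]
  mem_iff x v := by simp [hker, normalizeForm_apply_eq_zero_iff (hX x)]

theorem SmoothCodimOne.exists_definedBy (hG : SmoothCodimOne G.ξ) (hX : ∀ x, c.X x ∉ G.ξ x) :
    ∃ α : OneForm n L, SmoothFormOn α univ ∧ DefinedBy c α G.ξ := by
  choose U isOpen_U mem_U θ smooth_θ hker using hG
  have θ_X_ne {x y : L} (hy : y ∈ U x) : θ x y (c.X y) ≠ 0 :=
    mt (((hker x y hy).2 _).2) (hX y)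
  let θ' : OneForm n L := fun y => θ y y
  refine ⟨normalizeForm c.X θ' - c.γ, SmoothFormOn.sub ?_ c.smooth_γ,
    definedBy_normalizeForm_sub (fun x => θ_X_ne (mem_U x)) fun x => (hker x x (mem_U x)).2⟩
  intro V hV
  refine contMDiffOn_univ.2 fun x => ?_
  have smooth_near : SmoothFormOn (normalizeForm c.X (θ x)) (U x) :=
    (smooth_θ x).normalizeForm c.smooth_X fun y hy => θ_X_ne hy
  refine ((smooth_near V hV).contMDiffAt ((isOpen_U x).mem_nhds (mem_U x))).congr_of_eventuallyEq ?_
  filter_upwards [(isOpen_U x).mem_nhds (mem_U x)] with y hy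
  have normalizeForm_eq : normalizeForm c.X θ' y = normalizeForm c.X (θ x) y :=
    normalizeForm_congr (θ_X_ne (mem_U y)) (θ_X_ne hy) fun v hv =>
      ((hker x y hy).2 v).1 (((hker y y (mem_U y)).2 v).2 hv)
  rw [normalizeForm_eq]

theorem exists_deform_eq [T2Space L] (hF : IsLeviFlat F) (hG : IsLeviFlat G)
    (hclose : CloseTo c G) : ∃ p : ZOne c × ZeroOneForm F, InvertibleS p.2 ∧ deform c p = G := by
  obtain ⟨α, hα, h⟩ := hG.codim_one.exists_definedBy fun x => (hclose x).1
  obtain ⟨-, smooth_K, K_sq, -⟩ := (h.isLeviFlat_iff hα hF.involutive).1 hG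
  have isUnit_add := h.closeTo_iff_isUnit.1 hclose
  let J : smoothEnds F.ξ := ⟨F.J, hF.smooth_J⟩
  let K : smoothEnds F.ξ := ⟨h.conj G.J, smooth_K⟩
  let p : ZOne c × ZeroOneForm F := ⟨⟨α, hα, h.apply_X⟩, ⟨fun x => cayley (F.J x) (K.1 x),
    mul_mem (s := smoothEnds F.ξ) (SmoothEnd.inverse c (J + K).2 isUnit_add) (J - K).2,
    fun x => cayley_anticomm (hF.J_sq x) (K_sq x) (isUnit_add x)⟩⟩
  have hu : InvertibleS p.2 := fun x =>
    isUnit_one_add_cayley (isUnit_two_of_algebra ℝ) (hF.J_sq x) (isUnit_add x)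
  exact ⟨p, hu, (deform_eq_iff hu h).2 fun x =>
    semiconjBy_one_add_cayley (hF.J_sq x) (K_sq x) (isUnit_add x)⟩

theorem bijOn_deform [T2Space L] (hF : IsLeviFlat F) :
    BijOn (deform c) {p | p ∈ MC c ∧ InvertibleS p.2} {G | IsLeviFlat G ∧ CloseTo c G} := by
  refine ⟨fun p hp => ⟨(isLeviFlat_deform_iff hF hp.2).2 hp.1, closeTo_deform hF.J_sq hp.2⟩,
    (injOn_deform hF.J_sq).mono fun p hp => hp.2, fun G hG => ?_⟩
  obtain ⟨p, hp, rfl⟩ := exists_deform_eq hF hG.1 hG.2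
  exact ⟨p, ⟨(isLeviFlat_deform_iff hF hp).1 hG.1, hp⟩, rfl⟩

end Deform

/-! ### Diffeomorphisms -/

section Diffeo

variable {n : ℕ} {L : Type*} [TopologicalSpace L] [ChartedSpace (EuclideanSpace ℝ (Fin n)) L]
  (Φ : Diffeomorph (𝓡 n) (𝓡 n) L L ∞) {V W : VField n L}

/-- The differential of a diffeomorphism at a point, as a linear equivalence. -/
abbrev diffEquiv (x : L) : TangentSpace (𝓡 n) x ≃L[ℝ] TangentSpace (𝓡 n) (Φ x) :=
  Φ.mfderivToContinuousLinearEquiv (by simp) x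

theorem inverse_mfderiv_eq (x : L) : (mfderiv (𝓡 n) (𝓡 n) Φ x).inverse = (diffEquiv Φ x).symm :=
  ContinuousLinearMap.inverse_equiv (diffEquiv Φ x)

theorem mfderiv_injective (x : L) : Function.Injective (mfderiv (𝓡 n) (𝓡 n) Φ x) :=
  (diffEquiv Φ x).injective

theorem mfderiv_apply_of_eq_id {f : L → L} (hf : f = id) (x : L) (v : EuclideanSpace ℝ (Fin n)) :
    (mfderiv (𝓡 n) (𝓡 n) f x v : EuclideanSpace ℝ (Fin n)) = v := by
  subst hf
  rw [mfderiv_id]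
  rfl

theorem mfderiv_trans_apply (Ψ : Diffeomorph (𝓡 n) (𝓡 n) L L ∞) (x : L)
    (v : TangentSpace (𝓡 n) x) :
    mfderiv (𝓡 n) (𝓡 n) (Φ.trans Ψ) x v =
      mfderiv (𝓡 n) (𝓡 n) Ψ (Φ x) (mfderiv (𝓡 n) (𝓡 n) Φ x v) :=
  congrArg (fun A => A v) <|
    mfderiv_comp x (Ψ.mdifferentiable (by simp) (Φ x)) (Φ.mdifferentiable (by simp) x)

theorem mfderiv_mfderiv_symm (y : L) (v : EuclideanSpace ℝ (Fin n)) :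
    (mfderiv (𝓡 n) (𝓡 n) Φ (Φ.symm y) (mfderiv (𝓡 n) (𝓡 n) Φ.symm y v) :
      EuclideanSpace ℝ (Fin n)) = v :=
  (mfderiv_trans_apply Φ.symm Φ y v).symm.trans
    (mfderiv_apply_of_eq_id (funext Φ.apply_symm_apply) y v)

/-- The pull-back of a vector field by a diffeomorphism. -/
def pull (V : VField n L) : VField n L := VectorField.mpullback (𝓡 n) (𝓡 n) Φ V

theorem mfderiv_pull (V : VField n L) (x : L) :
    mfderiv (𝓡 n) (𝓡 n) Φ x (pull Φ V x) = V (Φ x) := by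
  rw [pull, VectorField.mpullback_apply, inverse_mfderiv_eq]
  exact (diffEquiv Φ x).apply_symm_apply _

theorem pull_symm_pull (V : VField n L) : pull Φ.symm (pull Φ V) = V := by
  ext1 y
  have mfderiv_symm_pull : mfderiv (𝓡 n) (𝓡 n) Φ.symm y (pull Φ.symm (pull Φ V) y) =
      pull Φ V (Φ.symm y) := mfderiv_pull Φ.symm (pull Φ V) y
  have mfderiv_pull_symm : mfderiv (𝓡 n) (𝓡 n) Φ (Φ.symm y) (pull Φ V (Φ.symm y)) =
      V (Φ (Φ.symm y)) := mfderiv_pull Φ V (Φ.symm y)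
  have apply_symm_apply : (V (Φ (Φ.symm y)) : EuclideanSpace ℝ (Fin n)) = V y := by
    rw [Φ.apply_symm_apply]
  rw [← mfderiv_symm_pull] at mfderiv_pull_symm
  exact (mfderiv_mfderiv_symm Φ y _).symm.trans (mfderiv_pull_symm.trans apply_symm_apply)

theorem pull_sub (V W : VField n L) : pull Φ (V - W) = pull Φ V - pull Φ W :=
  funext fun x => mfderiv_injective Φ x <| by
    rw [Pi.sub_apply, map_sub, mfderiv_pull, mfderiv_pull, mfderiv_pull, Pi.sub_apply]

theorem pull_zero : pull Φ (0 : VField n L) = 0 := by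
  simpa only [sub_self] using pull_sub Φ (0 : VField n L) 0

variable [IsManifold (𝓡 n) ∞ L]

theorem SmoothField.pull (hV : SmoothField V) : SmoothField (pull Φ V) :=
  ContMDiff.mpullback_vectorField (m := ∞) (n := ∞) hV Φ.contMDiff
    (fun x => ⟨diffEquiv Φ x, rfl⟩) (by simp)

theorem SmoothField.exists_pull_eq (hV : SmoothField V) :
    ∃ W, SmoothField W ∧ LeviFlat.pull Φ W = V :=
  ⟨_, hV.pull Φ.symm, pull_symm_pull Φ.symm V⟩

theorem pull_lie (hV : SmoothField V) (hW : SmoothField W) :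
    pull Φ (lie V W) = lie (pull Φ V) (pull Φ W) := by
  have : IsManifold (𝓡 n) (minSmoothness ℝ 2) L := by
    rw [minSmoothness_of_isRCLikeNormedField]
    infer_instance
  have : IsManifold (𝓡 n) (minSmoothness ℝ 3) L := by
    rw [minSmoothness_of_isRCLikeNormedField]
    infer_instance
  funext x
  exact VectorField.mpullback_mlieBracket (hV.mdifferentiableAt _) (hW.mdifferentiableAt _)
    (Φ.contMDiff x) (by
      rw [minSmoothness_of_isRCLikeNormedField]
      exact WithTop.coe_le_coe.2 le_top)

end Diffeo

section PullEndo

variable {n : ℕ} {L : Type*} [TopologicalSpace L] [ChartedSpace (EuclideanSpace ℝ (Fin n)) L]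
  {Φ : Diffeomorph (𝓡 n) (𝓡 n) L L ∞} {F G : EndoDistribution n L}
  {V W : VField n L}

/-- The pull-back of `(ξ', J')` by a diffeomorphism: the only structure that the diffeomorphism
carries to `(ξ', J')`. -/
def pullEndo (Φ : Diffeomorph (𝓡 n) (𝓡 n) L L ∞) (G : EndoDistribution n L) :
    EndoDistribution n L where
  ξ x := (G.ξ (Φ x)).comap
    ((diffEquiv Φ x).toLinearEquiv : TangentSpace (𝓡 n) x →ₗ[ℝ] TangentSpace (𝓡 n) (Φ x))
  J x := ((diffEquiv Φ x).toLinearEquiv.ofSubmodule' (G.ξ (Φ x))).symm.conjAlgEquiv ℝ (G.J (Φ x))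

theorem mem_pullEndo {x : L} {v : TangentSpace (𝓡 n) x} :
    v ∈ (pullEndo Φ G).ξ x ↔ mfderiv (𝓡 n) (𝓡 n) Φ x v ∈ G.ξ (Φ x) := Iff.rfl

theorem mfderiv_pullEndo_J {x : L} (v : (pullEndo Φ G).ξ x) :
    mfderiv (𝓡 n) (𝓡 n) Φ x ((pullEndo Φ G).J x v) =
      G.J (Φ x) ⟨mfderiv (𝓡 n) (𝓡 n) Φ x v, mem_pullEndo.1 v.2⟩ :=
  (diffEquiv Φ x).apply_symm_apply _

theorem pullEndo_J_mul_self {x : L} (hJ : G.J (Φ x) * G.J (Φ x) = -1) :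
    (pullEndo Φ G).J x * (pullEndo Φ G).J x = -1 := by
  let e := ((diffEquiv Φ x).toLinearEquiv.ofSubmodule' (G.ξ (Φ x))).symm.conjAlgEquiv ℝ
  have e_neg_one : e (-1) = -1 := by rw [map_neg, map_one]
  exact (map_mul e _ _).symm.trans ((congrArg e hJ).trans e_neg_one)

theorem isIsoBy_iff_eq_pullEndo : IsIsoBy Φ F G ↔ F = pullEndo Φ G := by
  refine ⟨fun h => ?_, ?_⟩
  · obtain ⟨ξ, J⟩ := F
    obtain rfl : ξ = (pullEndo Φ G).ξ := by
      ext x v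
      exact h.1 x v
    have J_eq : J = (pullEndo Φ G).J := funext fun x => LinearMap.ext fun v =>
      Subtype.ext <| mfderiv_injective Φ x <|
        (h.2 x v ⟨_, mem_pullEndo.1 v.2⟩ rfl).symm.trans (mfderiv_pullEndo_J v).symm
    rw [J_eq]
  · rintro rfl
    refine ⟨fun x v => Iff.rfl, fun x v w hw => ?_⟩
    obtain rfl : w = ⟨_, mem_pullEndo.1 v.2⟩ := Subtype.ext hw
    exact (mfderiv_pullEndo_J v).symm

theorem tangentTo_pull_iff : TangentTo (pullEndo Φ G).ξ (pull Φ V) ↔ TangentTo G.ξ V := by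
  refine Iff.trans (forall_congr' fun x => ?_) Φ.surjective.forall.symm
  rw [mem_pullEndo, mfderiv_pull]
  rfl

theorem pull_act (hV : TangentTo G.ξ V) :
    pull Φ (act G.J V) = act (pullEndo Φ G).J (pull Φ V) := by
  refine funext fun x => mfderiv_injective Φ x ?_
  rw [mfderiv_pull, act_apply _ hV, act_apply _ (tangentTo_pull_iff.2 hV), mfderiv_pullEndo_J]
  simp only [mfderiv_pull]

variable [IsManifold (𝓡 n) ∞ L]

theorem SmoothFormOn.comp_mfderiv {θ : OneForm n L} {U : Set L} (hθ : SmoothFormOn θ U) :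
    SmoothFormOn (fun x => (θ (Φ x)).comp (mfderiv (𝓡 n) (𝓡 n) Φ x)) (Φ ⁻¹' U) := by
  intro V hV
  obtain ⟨V, smooth_V, rfl⟩ := hV.exists_pull_eq Φ
  refine ((hθ V smooth_V).comp Φ.contMDiff.contMDiffOn fun x hx => hx).congr fun x _ => ?_
  rw [ContinuousLinearMap.comp_apply, mfderiv_pull, Function.comp_apply]

theorem SmoothCodimOne.pullEndo (hG : SmoothCodimOne G.ξ) :
    SmoothCodimOne (pullEndo Φ G).ξ := by
  intro x
  obtain ⟨U, isOpen_U, mem_U, θ, hθ, hker⟩ := hG (Φ x)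
  refine ⟨Φ ⁻¹' U, isOpen_U.preimage Φ.continuous, mem_U, _, hθ.comp_mfderiv, fun y hy =>
    ⟨fun h0 => (hker _ hy).1 (ContinuousLinearMap.ext fun w => ?_), fun v => (hker _ hy).2 _⟩⟩
  obtain ⟨v, rfl⟩ := (diffEquiv Φ y).surjective w
  exact congrArg (fun η => η v) h0

theorem Involutive.pullEndo (hG : Involutive G.ξ) : Involutive (pullEndo Φ G).ξ := by
  intro V W hV hW tV tW
  obtain ⟨V, smooth_V, rfl⟩ := hV.exists_pull_eq Φ
  obtain ⟨W, smooth_W, rfl⟩ := hW.exists_pull_eq Φ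
  rw [← pull_lie Φ smooth_V smooth_W, tangentTo_pull_iff]
  exact hG V W smooth_V smooth_W (tangentTo_pull_iff.1 tV) (tangentTo_pull_iff.1 tW)

theorem SmoothEnd.pullEndo (hG : SmoothEnd G.J) : SmoothEnd (pullEndo Φ G).J := by
  intro V hV tV
  obtain ⟨V, smooth_V, rfl⟩ := hV.exists_pull_eq Φ
  rw [tangentTo_pull_iff] at tV
  rw [← pull_act tV]
  exact (hG V smooth_V tV).pull Φ

theorem pull_nijenhuis (hG : SmoothEnd G.J) (hξ : Involutive G.ξ)
    (hV : V ∈ sections G.ξ) (hW : W ∈ sections G.ξ) :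
    pull Φ (nijenhuis lie (act G.J) V W) =
      nijenhuis lie (act (pullEndo Φ G).J) (pull Φ V) (pull Φ W) := by
  have smooth_JV := hG V hV.1 hV.2
  have smooth_JW := hG W hW.1 hW.2
  have tangent_JV := tangentTo_act G.J hV.2
  have tangent_JW := tangentTo_act G.J hW.2
  simp only [nijenhuis, pull_sub, pull_act hV.2, pull_act hW.2,
    pull_act (hξ _ _ smooth_JV hW.1 tangent_JV hW.2),
    pull_act (hξ _ _ hV.1 smooth_JW hV.2 tangent_JW),
    pull_lie Φ smooth_JV smooth_JW, pull_lie Φ hV.1 hW.1, pull_lie Φ smooth_JV hW.1,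
    pull_lie Φ hV.1 smooth_JW]

theorem IsLeviFlat.pullEndo (hG : IsLeviFlat G) : IsLeviFlat (pullEndo Φ G) where
  codim_one := hG.codim_one.pullEndo
  involutive := hG.involutive.pullEndo
  smooth_J := hG.smooth_J.pullEndo
  J_sq x := pullEndo_J_mul_self (hG.J_sq (Φ x))
  integrable V W hV hW tV tW := by
    obtain ⟨V, smooth_V, rfl⟩ := hV.exists_pull_eq Φ
    obtain ⟨W, smooth_W, rfl⟩ := hW.exists_pull_eq Φ
    rw [tangentTo_pull_iff] at tV tW
    rw [← pull_nijenhuis hG.smooth_J hG.involutive ⟨smooth_V, tV⟩ ⟨smooth_W, tW⟩,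
      hG.integrable V W smooth_V smooth_W tV tW, pull_zero]

end PullEndo

section Iso

variable {n : ℕ} {L : Type*} [TopologicalSpace L] [ChartedSpace (EuclideanSpace ℝ (Fin n)) L]
  {Φ Ψ : Diffeomorph (𝓡 n) (𝓡 n) L L ∞} {F G K : EndoDistribution n L}

theorem isIsoBy_refl (F : EndoDistribution n L) :
    IsIsoBy (Diffeomorph.refl (𝓡 n) L ∞) F F := by
  have mfderiv_refl (x : L) (v : TangentSpace (𝓡 n) x) :
      mfderiv (𝓡 n) (𝓡 n) (Diffeomorph.refl (𝓡 n) L ∞) x v = v :=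
    mfderiv_apply_of_eq_id (Diffeomorph.coe_refl (𝓡 n) L ∞) x v
  refine ⟨fun x v => ?_, fun x v w hw => ?_⟩
  · rw [mfderiv_refl]
    rfl
  · obtain rfl : w = v := Subtype.ext (hw.trans (mfderiv_refl x v))
    exact (mfderiv_refl x _).symm

theorem IsIsoBy.mem_iff_of_eq (h : IsIsoBy Φ F G) {x y : L} (hxy : Φ x = y)
    (v : TangentSpace (𝓡 n) x) (w : TangentSpace (𝓡 n) y)
    (hw : (w : EuclideanSpace ℝ (Fin n)) = mfderiv (𝓡 n) (𝓡 n) Φ x v) :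
    v ∈ F.ξ x ↔ w ∈ G.ξ y := by
  subst hxy
  rw [h.1 x v]
  exact iff_of_eq (congrArg (· ∈ G.ξ (Φ x)) hw.symm)

theorem IsIsoBy.J_of_eq (h : IsIsoBy Φ F G) {x y : L} (hxy : Φ x = y)
    (v : F.ξ x) (w : G.ξ y)
    (hw : ((w : TangentSpace (𝓡 n) y) : EuclideanSpace ℝ (Fin n)) = mfderiv (𝓡 n) (𝓡 n) Φ x v) :
    ((G.J y w : TangentSpace (𝓡 n) y) : EuclideanSpace ℝ (Fin n)) =
      mfderiv (𝓡 n) (𝓡 n) Φ x (F.J x v : TangentSpace (𝓡 n) x) := by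
  subst hxy
  exact h.2 x v w hw

theorem IsIsoBy.symm (h : IsIsoBy Φ F G) : IsIsoBy Φ.symm G F := by
  refine ⟨fun y v => ?_, fun y v w hw => mfderiv_injective Φ (Φ.symm y) ?_⟩
  · exact (h.mem_iff_of_eq (Φ.apply_symm_apply y) (mfderiv (𝓡 n) (𝓡 n) Φ.symm y v) v
      (mfderiv_mfderiv_symm Φ y v).symm).symm
  · have J_apply := h.J_of_eq (Φ.apply_symm_apply y) w v <|
      hw ▸ (mfderiv_mfderiv_symm Φ y (v : TangentSpace (𝓡 n) y)).symm
    exact J_apply.symm.trans (mfderiv_mfderiv_symm Φ y (G.J y v : TangentSpace (𝓡 n) y)).symm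

theorem IsIsoBy.trans (h : IsIsoBy Φ F G) (h' : IsIsoBy Ψ G K) : IsIsoBy (Φ.trans Ψ) F K := by
  refine ⟨fun x v => ?_, fun x v w hw => ?_⟩
  · rw [h.1, h'.1, mfderiv_trans_apply]
    rfl
  · have hv := (h.1 x v).1 v.2
    have G_J_apply := h.2 x v ⟨_, hv⟩ rfl
    have K_J_apply := h'.2 (Φ x) ⟨_, hv⟩ w (hw.trans (mfderiv_trans_apply Φ Ψ x v))
    rw [mfderiv_trans_apply, ← G_J_apply]
    exact K_J_apply

theorem isomorphic_equivalence :
    Equivalence (Isomorphic : EndoDistribution n L → EndoDistribution n L → Prop) :=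
  ⟨fun F => ⟨_, isIsoBy_refl F⟩, fun ⟨_, h⟩ => ⟨_, h.symm⟩, fun ⟨_, h⟩ ⟨_, h'⟩ => ⟨_, h.trans h'⟩⟩

end Iso

/-! ### The gauge action -/

section Gauge

variable {n : ℕ} {L : Type*} [TopologicalSpace L] [ChartedSpace (EuclideanSpace ℝ (Fin n)) L]
  [IsManifold (𝓡 n) ∞ L] {F : EndoDistribution n L} {c : DefiningCouple F.ξ}
  {Φ : Diffeomorph (𝓡 n) (𝓡 n) L L ∞} {p q : ZOne c × ZeroOneForm F}

theorem definedBy_chi (hX : ∀ x, pullForm c Φ p.1 x (c.X x) ≠ 0) :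
    DefinedBy c (chi c Φ p.1) (pullEndo Φ (deform c p)).ξ :=
  definedBy_normalizeForm_sub hX fun _ _ => Iff.rfl

theorem conj_pullEndo_deform (hX : ∀ x, pullForm c Φ p.1 x (c.X x) ≠ 0) :
    (definedBy_chi hX).conj (pullEndo Φ (deform c p)).J = pulledJ c Φ p := by
  ext1 x
  refine LinearMap.ext fun v => congrArg (proj c x) ?_
  rw [inverse_mfderiv_eq]
  rfl

theorem gaugeDefined_iff_closeTo :
    GaugeDefined c Φ p ↔ CloseTo c (pullEndo Φ (deform c p)) := by
  have closeTo_iff (hX : ∀ x, pullForm c Φ p.1 x (c.X x) ≠ 0) :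
      CloseTo c (pullEndo Φ (deform c p)) ↔ ∀ x, IsUnit (F.J x + pulledJ c Φ p x) := by
    rw [(definedBy_chi hX).closeTo_iff_isUnit, conj_pullEndo_deform hX]
  refine ⟨fun h => (closeTo_iff fun x => (h x).1).2 fun x => (h x).2, fun h => ?_⟩
  have hX (x : L) : pullForm c Φ p.1 x (c.X x) ≠ 0 := (h x).1
  exact fun x => ⟨hX x, (closeTo_iff hX).1 h x⟩

theorem pulledJ_mul_self (hJ : ∀ x, F.J x * F.J x = -1) (hp : InvertibleS p.2)
    (hX : ∀ x, pullForm c Φ p.1 x (c.X x) ≠ 0) (x : L) :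
    pulledJ c Φ p x * pulledJ c Φ p x = -1 := by
  rw [← conj_pullEndo_deform hX, DefinedBy.conj_mul_self_eq_neg_one_iff]
  refine pullEndo_J_mul_self ((definedBy_deform p).conj_mul_self_eq_neg_one_iff.1 ?_)
  rw [conj_deform]
  exact mul_self_eq_neg_one_of_semiconjBy (hJ _) (hp _) (semiconjBy_twist hp _)

theorem gaugeBy_iff_deform_eq (hJ : ∀ x, F.J x * F.J x = -1) (hp : InvertibleS p.2)
    (hq : InvertibleS q.2) : GaugeBy c Φ p q ↔ deform c q = pullEndo Φ (deform c p) := by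
  have deform_eq_iff_cayley (hX : ∀ x, pullForm c Φ p.1 x (c.X x) ≠ 0)
      (hβ : q.1.1 = chi c Φ p.1) : deform c q = pullEndo Φ (deform c p) ↔
        ∀ x, IsUnit (F.J x + pulledJ c Φ p x) ∧ q.2.1 x = gaugeS c Φ p x := by
    obtain ⟨⟨_, hα⟩, Q⟩ := q
    subst hβ
    rw [deform_eq_iff hq (definedBy_chi hX), conj_pullEndo_deform hX]
    exact forall_congr' fun x => semiconjBy_one_add_iff_eq_cayley (isUnit_two_of_algebra ℝ)
      (hJ x) (pulledJ_mul_self hJ hp hX x) (Q.2.2 x) (hq x)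
  refine ⟨fun ⟨hdef, hβ, hQ⟩ => (deform_eq_iff_cayley (fun x => (hdef x).1) hβ).2
    fun x => ⟨(hdef x).2, congrFun hQ x⟩, fun h => ?_⟩
  have hdef : GaugeDefined c Φ p := gaugeDefined_iff_closeTo.2 (h ▸ closeTo_deform hJ hq)
  have hX (x : L) := (hdef x).1
  have hβ : q.1.1 = chi c Φ p.1 := (h ▸ definedBy_deform q).unique (definedBy_chi hX)
  exact ⟨hdef, hβ, funext fun x => ((deform_eq_iff_cayley hX hβ).1 h x).2⟩

theorem gaugeEquiv_iff_isomorphic (hJ : ∀ x, F.J x * F.J x = -1) (p q : MCPair c) :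
    GaugeEquiv c p q ↔ Isomorphic (deform c p.1) (deform c q.1) := by
  have gaugeEquiv_iff : GaugeEquiv c p q ↔ Isomorphic (deform c q.1) (deform c p.1) :=
    exists_congr fun _ =>
      (gaugeBy_iff_deform_eq hJ p.2.2 q.2.2).trans isIsoBy_iff_eq_pullEndo.symm
  exact gaugeEquiv_iff.trans ⟨isomorphic_equivalence.symm, isomorphic_equivalence.symm⟩

theorem gaugeEquiv_equivalence (hJ : ∀ x, F.J x * F.J x = -1) : Equivalence (GaugeEquiv c) := by
  have gaugeEquiv_eq :
      GaugeEquiv c = InvImage Isomorphic (fun p : MCPair c => deform c p.1) := by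
    ext p q
    exact gaugeEquiv_iff_isomorphic hJ p q
  rw [gaugeEquiv_eq]
  exact isomorphic_equivalence.comap _

variable [T2Space L]

theorem existsUnique_gaugeBy (hF : IsLeviFlat F) (p : MCPair c) (h : GaugeDefined c Φ p.1) :
    ∃! q : MCPair c, GaugeBy c Φ p.1 q.1 := by
  have isLeviFlat_p : IsLeviFlat (deform c p.1) := (isLeviFlat_deform_iff hF p.2.2).2 p.2.1
  obtain ⟨q, hq, deform_q⟩ :=
    (bijOn_deform hF).surjOn ⟨isLeviFlat_p.pullEndo, gaugeDefined_iff_closeTo.1 h⟩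
  refine ⟨⟨q, hq⟩, (gaugeBy_iff_deform_eq hF.J_sq p.2.2 hq.2).2 deform_q, fun q' hq' => ?_⟩
  exact Subtype.ext <| injOn_deform hF.J_sq q'.2.2 hq.2 <|
    ((gaugeBy_iff_deform_eq hF.J_sq p.2.2 q'.2.2).1 hq').trans deform_q.symm

/-- The bijection from the solutions onto the deformations. -/
def deformEquiv (hF : IsLeviFlat F) : MCPair c ≃ Deformation c :=
  (bijOn_deform hF).equiv (deform c)

/-- The bijection from the solutions modulo gauge equivalence onto the moduli space. -/
def moduliEquiv (hF : IsLeviFlat F) : MCQuotient c ≃ ModuliSpace c :=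
  Quot.congr (deformEquiv hF) (gaugeEquiv_iff_isomorphic hF.J_sq)

end Gauge

end LeviFlat

end

open LeviFlat in
theorem mainTheorem5_general {n : ℕ} {L : Type*} [TopologicalSpace L] [T2Space L]
    [ChartedSpace (EuclideanSpace ℝ (Fin n)) L]
    [IsManifold (𝓡 n) ∞ L] (F : EndoDistribution n L) (hF : IsLeviFlat F)
    (c : DefiningCouple F.ξ) :
    (∀ p : ZOne c × ZeroOneForm F, InvertibleS p.2 → (IsLeviFlat (deform c p) ↔ p ∈ MC c)) ∧
    (∀ p : ZOne c × ZeroOneForm F, (∀ x, p.1.1 x = 0) → (∀ x, p.2.1 x = 0) → deform c p = F) ∧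
    BijOn (deform c) {p | p ∈ MC c ∧ InvertibleS p.2} {G | IsLeviFlat G ∧ CloseTo c G} ∧
    (∀ (p : MCPair c) (Φ : Diffeomorph (𝓡 n) (𝓡 n) L L ∞), GaugeDefined c Φ p.1 →
      ∃! q : MCPair c, GaugeBy c Φ p.1 q.1) ∧
    Equivalence (GaugeEquiv c) ∧
    (∀ p q : MCPair c, GaugeEquiv c p q ↔ Isomorphic (deform c p.1) (deform c q.1)) ∧
    ∃ e : MCQuotient c ≃ ModuliSpace c, ∀ (p : MCPair c) (G : Deformation c),
      deform c p.1 = G.1 → e (Quot.mk _ p) = Quot.mk _ G :=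
  ⟨fun _ => isLeviFlat_deform_iff hF, fun _ => deform_zero, bijOn_deform hF,
    fun p _ => existsUnique_gaugeBy hF p, gaugeEquiv_equivalence hF.J_sq,
    gaugeEquiv_iff_isomorphic hF.J_sq, moduliEquiv hF,
    fun _ _ h => congrArg (Quot.mk _) (Subtype.ext h)⟩

open LeviFlat in
theorem mainTheorem5 {n : ℕ} {L : Type*} [TopologicalSpace L] [T2Space L]
    [SecondCountableTopology L] [ChartedSpace (EuclideanSpace ℝ (Fin n)) L]
    [IsManifold (𝓡 n) ∞ L] (F : EndoDistribution n L) (hF : IsLeviFlat F)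
    (c : DefiningCouple F.ξ) :
    -- the structure defined by a pair is Levi flat exactly for the solutions
    (∀ p : ZOne c × ZeroOneForm F, InvertibleS p.2 → (IsLeviFlat (deform c p) ↔ p ∈ MC c)) ∧
    -- the pair `(0, 0)` defines `(ξ, J)`
    (∀ p : ZOne c × ZeroOneForm F, (∀ x, p.1.1 x = 0) → (∀ x, p.2.1 x = 0) → deform c p = F) ∧
    -- the deformations are parametrised by the solutions
    BijOn (deform c) {p | p ∈ MC c ∧ InvertibleS p.2} {G | IsLeviFlat G ∧ CloseTo c G} ∧
    -- a diffeomorphism takes solutions to solutions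
    (∀ (p : MCPair c) (Φ : Diffeomorph (𝓡 n) (𝓡 n) L L ∞), GaugeDefined c Φ p.1 →
      ∃! q : MCPair c, GaugeBy c Φ p.1 q.1) ∧
    -- gauge equivalence is an equivalence relation; it is isomorphism of the structures
    Equivalence (GaugeEquiv c) ∧
    (∀ p q : MCPair c, GaugeEquiv c p q ↔ Isomorphic (deform c p.1) (deform c q.1)) ∧
    -- the moduli space is the set of solutions modulo gauge equivalence
    ∃ e : MCQuotient c ≃ ModuliSpace c, ∀ (p : MCPair c) (G : Deformation c),
      deform c p.1 = G.1 → e (Quot.mk _ p) = Quot.mk _ G :=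
  mainTheorem5_general F hF c
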